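/- Conventions. A dagger category is a category with an operation $f\mapsto f^\dagger$ sending $f\colon X\to Y$ to $f^\dagger\colon Y\to X$ such that $\mathrm{id}^\dagger=\mathrm{id}$, $f^{\dagger\dagger}=f$ and $(f\circ g)^\dagger=g^\dagger\circ f^\dagger$. A morphism $m$ is dagger monic if $m^\dagger\circ m=\mathrm{id}$, and a dagger isomorphism if it is invertible with $m^{-1}=m^\dagger$. A dagger symmetric monoidal category is a dagger category with a symmetric monoidal structure $(\otimes,I)$ such that $(f\otimes g)^\dagger=f^\dagger\otimes g^\dagger$ and the associators, unitors and braidings $\beta$ are dagger isomorphisms. It is dagger compact closed if for every object $X$ there are an object $X^*$ and a morphism $\eta\colon I\to X^*\otimes X$ such that $\eta$ and $\varepsilon=\eta^\dagger\circ\beta_{X,X^*}\colon X\otimes X^*\to I$ satisfy the two triangle identities. A dagger biproduct of a family $(X_m)_{m\in M}$ is an object with projections $p_m$ and injections $i_m$ making it both a product and a coproduct of the family, with $p_m\circ i_m=\mathrm{id}$, $p_m\circ i_n=0$ for $m\neq n$, and $p_m=i_m^\dagger$. A dagger kernel is a dagger monic morphism that is a kernel of some morphism; for a dagger kernel $k$,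 $k^\perp$ denotes a dagger monic kernel of $k^\dagger$. $\mathbf{Rel}$ is the category of sets and binary relations with the converse as dagger, the Cartesian product as $\otimes$, and a one-element set $\{*\}$ as unit. Theorem. Let $(\mathbf C,\otimes,I,\dagger)$ be a (locally small) dagger compact closed category such that 1. each (set-indexed) family of objects has a dagger biproduct; 2. each morphism has a kernel that is dagger monic; 3. $k$ and $k^\perp$ are jointly epic for each dagger kernel $k$, i.e. $f=g$ whenever $f\circ k=g\circ k$ and $f\circ k^\perp=g\circ k^\perp$; 4. $I$ is not a zero object; 5. each nonzero morphism $I\to I$ is invertible; 6. $I$ is a separator, i.e. the morphisms $I\to X$ are jointly epic for each object $X$. For a family of morphisms $r_m\colon X\to Y$ $(m \in M)$ put $\sum_m r_m=\Delta_Y^\dagger\circ\bigl(\bigoplus_m r_m\bigr)\circ\Delta_X$, where $\Delta_X\colon X\to\bigoplus_m X$ and $\Delta_Y\colon Y\to\bigoplus_m Y$ are the diagonals, and order $\mathbf C(X,Y)$ by $r\le s\iff r+s=s$. An atom of $\mathbf C(I,X)$ is a nonzero $a\colon I\to X$ such that every $b\le a$ is $0$ or $a$. Let $E(X)$ be the set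 of atoms of $\mathbf C(I,X)$ and, for $r\colon X\to Y$, let $E(r)=\{(x,y)\in E(X)\times E(Y)\mid y^\dagger\circ r\circ x=\mathrm{id}_I\}$. Then $E$ is a functor $\mathbf C\to\mathbf{Rel}$, and it is a strong symmetric monoidal dagger equivalence: it is full and faithful, $E(r^\dagger)=E(r)^\dagger$ for all $r$, every set is dagger isomorphic to some $E(X)$, and $E$ is a strong symmetric monoidal functor $(\mathbf C,\otimes,I)\to(\mathbf{Rel},\times,\{*\})$ whose coherence isomorphisms are the dagger isomorphisms $\{*\}\to E(I)$, $*\mapsto \mathrm{id}_I$, and $E(X)\times E(Y)\to E(X\otimes Y)$, $(x,y)\mapsto (x\otimes y)\circ\lambda_I^{-1}$ (where $\lambda_I\colon I\otimes I\to I$ is the unitor). Conversely, $\mathbf{Rel}$ is a dagger compact closed category satisfying (1)-(6). -/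

import Mathlib

open CategoryTheory CategoryTheory.Limits CategoryTheory.MonoidalCategory

universe v u

/-- A dagger category: every morphism `f : X ⟶ Y` has an adjoint `dagger f : Y ⟶ X`, and `dagger`
is an involutive, identity-on-objects, contravariant functor. -/
class DaggerCategory (C : Type u) [Category.{v} C] where
  dagger : ∀ {X Y : C}, (X ⟶ Y) → (Y ⟶ X)
  dagger_id : ∀ X : C, dagger (𝟙 X) = 𝟙 X
  dagger_dagger : ∀ {X Y : C} (f : X ⟶ Y), dagger (dagger f) = f
  dagger_comp : ∀ {X Y Z : C} (f : X ⟶ Y) (g : Y ⟶ Z), dagger (f ≫ g) = dagger g ≫ dagger f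

postfix:max "‡" => DaggerCategory.dagger

section DaggerNotions

variable {C : Type u} [Category.{v} C] [DaggerCategory C]

/-- A dagger monomorphism. -/
def IsDaggerMono {X Y : C} (m : X ⟶ Y) : Prop := m ≫ m‡ = 𝟙 X

/-- A dagger isomorphism: the inverse is the dagger. -/
def IsDaggerIso {X Y : C} (m : X ⟶ Y) : Prop := m ≫ m‡ = 𝟙 X ∧ m‡ ≫ m = 𝟙 Y

/-- A dagger symmetric monoidal category: a dagger category with a symmetric monoidal structure
whose product is a dagger functor and whose associators, unitors and braidings are dagger
isomorphisms. -/
class IsDaggerSymmetricMonoidal (C : Type u) [Category.{v} C] [DaggerCategory C]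
    [MonoidalCategory C] [SymmetricCategory C] : Prop where
  dagger_tensorHom : ∀ {X₁ Y₁ X₂ Y₂ : C} (f : X₁ ⟶ Y₁) (g : X₂ ⟶ Y₂),
    (f ⊗ₘ g)‡ = f‡ ⊗ₘ g‡
  associator : ∀ X Y Z : C, IsDaggerIso (α_ X Y Z).hom
  leftUnitor : ∀ X : C, IsDaggerIso (λ_ X).hom
  rightUnitor : ∀ X : C, IsDaggerIso (ρ_ X).hom
  braiding : ∀ X Y : C, IsDaggerIso (β_ X Y).hom

/-- `D` is a dagger dual of `X`: there is `η : I ⟶ D ⊗ X` such that `η` and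
`ε = η‡ ∘ β : X ⊗ D ⟶ I` satisfy the two triangle identities. -/
def IsDaggerDual [MonoidalCategory C] [SymmetricCategory C] (X D : C) : Prop :=
  ∃ p : ExactPairing D X, p.evaluation' = (β_ X D).hom ≫ (p.coevaluation')‡

/-- A dagger compact closed category: a dagger symmetric monoidal category in which every object
has a dagger dual. -/
class IsDaggerCompactClosed (C : Type u) [Category.{v} C] [DaggerCategory C]
    [MonoidalCategory C] [SymmetricCategory C] : Prop extends IsDaggerSymmetricMonoidal C where
  exists_dual : ∀ X : C, ∃ D : C, IsDaggerDual X D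

/-- A functor that preserves daggers. -/
def IsDaggerFunctor {D : Type*} [Category* D] [DaggerCategory D] (F : C ⥤ D) : Prop :=
  ∀ {X Y : C} (f : X ⟶ Y), F.map (f‡) = (F.map f)‡

/-- A dagger equivalence: a full and faithful dagger functor such that every object of the
codomain is dagger isomorphic to one in the image. -/
structure IsDaggerEquivalence {D : Type*} [Category* D] [DaggerCategory D] (F : C ⥤ D) :
    Prop where
  isDagger : IsDaggerFunctor F
  full : F.Full
  faithful : F.Faithful
  essSurj : ∀ Y : D, ∃ (X : C) (i : F.obj X ⟶ Y), IsDaggerIso i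

variable [HasZeroMorphisms C]

/-- A dagger biproduct of a family of objects: a biproduct (simultaneously a product and a
coproduct, with `ι i ≫ π j` the identity for `i = j` and zero otherwise) whose projections are the
daggers of its injections. -/
structure DaggerBiproduct {M : Type*} (f : M → C) where
  bicone : Bicone f
  isBilimit : bicone.IsBilimit
  π_eq : ∀ m, bicone.π m = (bicone.ι m)‡

/-- `k` is a kernel of `f`. -/
def IsKernelOf {A X Y : C} (k : A ⟶ X) (f : X ⟶ Y) : Prop :=
  ∃ w : k ≫ f = 0, Nonempty (IsLimit (KernelFork.ofι k w))

/-- A dagger kernel: a dagger monomorphism that is a kernel of some morphism. -/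
def IsDaggerKernel {A X : C} (k : A ⟶ X) : Prop :=
  IsDaggerMono k ∧ ∃ (Y : C) (f : X ⟶ Y), IsKernelOf k f

/-- `k'` is a complement `k^⊥ = ker (k‡)` of `k`, the kernel being taken dagger monic. -/
def IsDaggerComplement {A A' X : C} (k' : A' ⟶ X) (k : A ⟶ X) : Prop :=
  IsDaggerMono k' ∧ IsKernelOf k' (k‡)

/-- Two morphisms with the same codomain are jointly epic. -/
def JointlyEpic {A A' X : C} (k : A ⟶ X) (k' : A' ⟶ X) : Prop :=
  ∀ {Y : C} (f g : X ⟶ Y), k ≫ f = k ≫ g → k' ≫ f = k' ≫ g → f = g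

variable (C) in
/-- Every family of objects, indexed by a set, has a dagger biproduct. -/
def HasDaggerBiproducts : Prop :=
  ∀ (M : Type v) (f : M → C), Nonempty (DaggerBiproduct f)

/-- The six hypotheses on a dagger compact closed category. -/
structure RelAxioms (C : Type u) [Category.{v} C] [DaggerCategory C] [HasZeroMorphisms C]
    [MonoidalCategory C] : Prop where
  biproducts : HasDaggerBiproducts C
  kernels : ∀ {X Y : C} (f : X ⟶ Y), ∃ (A : C) (k : A ⟶ X), IsKernelOf k f ∧ IsDaggerMono k
  jointlyEpic : ∀ {A A' X : C} (k : A ⟶ X) (k' : A' ⟶ X),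
    IsDaggerKernel k → IsDaggerComplement k' k → JointlyEpic k k'
  unit_nonzero : ¬ IsZero (𝟙_ C)
  scalar_invertible : ∀ s : 𝟙_ C ⟶ 𝟙_ C, s ≠ 0 → IsIso s
  separator : IsSeparator (𝟙_ C)

end DaggerNotions

noncomputable section AtomFunctor

variable {C : Type u} [Category.{v} C] [DaggerCategory C] [HasZeroMorphisms C]

/-- The diagonal morphism `Y ⟶ ⨁_{m ∈ M} Y` into a dagger biproduct of copies of `Y`. -/
def DaggerBiproduct.diag {M : Type*} {Y : C} (B : DaggerBiproduct fun _ : M => Y) :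
    Y ⟶ B.bicone.pt :=
  B.isBilimit.isLimit.lift (Fan.mk Y fun _ => 𝟙 Y)

/-- The morphism `⨁ r_m : ⨁ X_m ⟶ ⨁ Y_m` between dagger biproducts. -/
def DaggerBiproduct.map {M : Type*} {X Y : M → C} (A : DaggerBiproduct X) (B : DaggerBiproduct Y)
    (r : ∀ m, X m ⟶ Y m) : A.bicone.pt ⟶ B.bicone.pt :=
  B.isBilimit.isLimit.lift (Fan.mk A.bicone.pt fun m => A.bicone.π m ≫ r m)

/-- The sum `∑ r_m = Δ‡ ∘ (⨁ r_m) ∘ Δ` of a family of parallel morphisms. It does not depend on the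
chosen biproducts. -/
def homSum (h : HasDaggerBiproducts C) {M : Type v} {X Y : C} (r : M → (X ⟶ Y)) : X ⟶ Y :=
  (h M fun _ => X).some.diag ≫ (h M fun _ => X).some.map (h M fun _ => Y).some r ≫
    ((h M fun _ => Y).some.diag)‡

/-- The sum of two parallel morphisms. -/
def homAdd (h : HasDaggerBiproducts C) {X Y : C} (r s : X ⟶ Y) : X ⟶ Y :=
  homSum h fun b : ULift.{v} Bool => if b.down then r else s

/-- The order on morphisms: `r ≤ s` when `r + s = s`. -/
def homLE (h : HasDaggerBiproducts C) {X Y : C} (r s : X ⟶ Y) : Prop :=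
  homAdd h r s = s

/-- An atom of a hom set: a minimal nonzero morphism. -/
def IsHomAtom (h : HasDaggerBiproducts C) {X Y : C} (a : X ⟶ Y) : Prop :=
  a ≠ 0 ∧ ∀ b : X ⟶ Y, homLE h b a → b = 0 ∨ b = a

variable [MonoidalCategory C]

/-- The set `E(X)` of atoms of `C(I, X)`. -/
def AtomObj (h : HasDaggerBiproducts C) (X : C) : RelCat.{v} :=
  {a : 𝟙_ C ⟶ X // IsHomAtom h a}

/-- The underlying morphism of an element of `E(X)`. -/
def AtomObj.mor {h : HasDaggerBiproducts C} {X : C} (a : AtomObj h X) : 𝟙_ C ⟶ X :=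
  Subtype.val a

/-- The relation `E(r) = {(x, y) | y‡ ∘ r ∘ x = 1}`. -/
def atomMap (h : HasDaggerBiproducts C) {X Y : C} (r : X ⟶ Y) : AtomObj h X ⟶ AtomObj h Y :=
  RelCat.Hom.ofRel {p | p.1.mor ≫ r ≫ (p.2.mor)‡ = 𝟙 (𝟙_ C)}

/-- The assignment `E` is functorial. -/
structure AtomFunctorial (h : HasDaggerBiproducts C) : Prop where
  map_id : ∀ X : C, atomMap h (𝟙 X) = 𝟙 (AtomObj h X)
  map_comp : ∀ {X Y Z : C} (r : X ⟶ Y) (s : Y ⟶ Z),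
    atomMap h (r ≫ s) = atomMap h r ≫ atomMap h s

/-- The functor `E`. -/
def atomFunctor (h : HasDaggerBiproducts C) (hE : AtomFunctorial h) : C ⥤ RelCat.{v} where
  obj := AtomObj h
  map := atomMap h
  map_id := hE.map_id
  map_comp := hE.map_comp

end AtomFunctor

section Rel

/-- The dagger of a relation is its converse. -/
instance RelCat.instDaggerCategory : DaggerCategory RelCat.{v} where
  dagger r := RelCat.Hom.ofRel {p | (p.2, p.1) ∈ r.rel}
  dagger_id X := by
    ext ⟨x, y⟩
    exact ⟨fun h => Eq.symm h, fun h => Eq.symm h⟩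
  dagger_dagger _ := rfl
  dagger_comp r s := by
    ext ⟨x, y⟩
    exact ⟨fun ⟨z, h₁, h₂⟩ => ⟨z, h₂, h₁⟩, fun ⟨z, h₁, h₂⟩ => ⟨z, h₂, h₁⟩⟩

/-- The zero morphisms of the category of relations are the empty relations. -/
instance RelCat.instHasZeroMorphisms : HasZeroMorphisms RelCat.{v} where
  zero X Y := ⟨RelCat.Hom.ofRel ∅⟩
  comp_zero r Z := by
    ext ⟨x, y⟩
    exact ⟨fun ⟨_, _, h⟩ => h.elim, fun h => h.elim⟩
  zero_comp X {Y Z} r := by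
    ext ⟨x, y⟩
    exact ⟨fun ⟨_, h, _⟩ => h.elim, fun h => h.elim⟩

/-- The isomorphism of the category of relations given by (the graph of) a bijection. -/
def RelCat.isoOfEquiv {X Y : Type v} (e : X ≃ Y) :
    Iso (C := RelCat.{v}) X Y where
  hom := RelCat.Hom.ofRel {p | e p.1 = p.2}
  inv := RelCat.Hom.ofRel {p | e p.2 = p.1}
  hom_inv_id := by
    ext ⟨x, y⟩
    exact ⟨fun ⟨_, h₁, h₂⟩ => e.injective (h₁.trans h₂.symm),
      fun h => ⟨e x, rfl, congrArg e (Eq.symm h)⟩⟩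
  inv_hom_id := by
    ext ⟨x, y⟩
    exact ⟨fun ⟨_, h₁, h₂⟩ => h₁.symm.trans h₂,
      fun h => ⟨e.symm x, e.apply_symm_apply x, (e.apply_symm_apply x).trans h⟩⟩

/-- The data of the monoidal structure on the category of relations: the Cartesian product of sets,
the product of relations, a one-element set, and the usual bijections. -/
instance RelCat.instMonoidalCategoryStruct : MonoidalCategoryStruct RelCat.{v} where
  tensorObj X Y := @Prod.{v, v} X Y
  whiskerLeft _ {_ _} r := RelCat.Hom.ofRel {p | p.1.1 = p.2.1 ∧ (p.1.2, p.2.2) ∈ r.rel}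
  whiskerRight {_ _} r _ := RelCat.Hom.ofRel {p | (p.1.1, p.2.1) ∈ r.rel ∧ p.1.2 = p.2.2}
  tensorHom r s := RelCat.Hom.ofRel {p | (p.1.1, p.2.1) ∈ r.rel ∧ (p.1.2, p.2.2) ∈ s.rel}
  tensorUnit := PUnit.{v + 1}
  associator X Y Z := RelCat.isoOfEquiv (Equiv.prodAssoc X Y Z)
  leftUnitor X := RelCat.isoOfEquiv (Equiv.punitProd X)
  rightUnitor X := RelCat.isoOfEquiv (Equiv.prodPUnit X)

instance RelCat.instMonoidalCategory : MonoidalCategory RelCat.{v} where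
  tensorHom_def r s := by
    ext ⟨⟨x₁, x₂⟩, ⟨y₁, y₂⟩⟩
    constructor
    · rintro ⟨h₁, h₂⟩
      exact ⟨(y₁, x₂), ⟨h₁, rfl⟩, ⟨rfl, h₂⟩⟩
    · rintro ⟨⟨z₁, z₂⟩, ⟨h₁, h₂⟩, ⟨h₃, h₄⟩⟩
      obtain rfl : x₂ = z₂ := h₂
      obtain rfl : z₁ = y₁ := h₃
      exact ⟨h₁, h₄⟩
  id_tensorHom_id X Y := by
    ext ⟨⟨x₁, x₂⟩, ⟨y₁, y₂⟩⟩
    exact ⟨fun ⟨h₁, h₂⟩ => Prod.ext h₁ h₂, fun h => ⟨congrArg Prod.fst h, congrArg Prod.snd h⟩⟩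
  tensorHom_comp_tensorHom r₁ r₂ s₁ s₂ := by
    ext ⟨⟨x₁, x₂⟩, ⟨z₁, z₂⟩⟩
    constructor
    · rintro ⟨⟨y₁, y₂⟩, ⟨h₁, h₂⟩, ⟨h₃, h₄⟩⟩
      exact ⟨⟨y₁, h₁, h₃⟩, ⟨y₂, h₂, h₄⟩⟩
    · rintro ⟨⟨y₁, h₁, h₃⟩, ⟨y₂, h₂, h₄⟩⟩
      exact ⟨⟨y₁, y₂⟩, ⟨h₁, h₂⟩, ⟨h₃, h₄⟩⟩
  whiskerLeft_id X Y := by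
    ext ⟨⟨x₁, x₂⟩, ⟨y₁, y₂⟩⟩
    exact ⟨fun ⟨h₁, h₂⟩ => Prod.ext h₁ h₂, fun h => ⟨congrArg Prod.fst h, congrArg Prod.snd h⟩⟩
  id_whiskerRight X Y := by
    ext ⟨⟨x₁, x₂⟩, ⟨y₁, y₂⟩⟩
    exact ⟨fun ⟨h₁, h₂⟩ => Prod.ext h₁ h₂, fun h => ⟨congrArg Prod.fst h, congrArg Prod.snd h⟩⟩
  associator_naturality r₁ r₂ r₃ := by
    ext ⟨⟨⟨x₁, x₂⟩, x₃⟩, ⟨y₁, y₂, y₃⟩⟩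
    constructor
    · rintro ⟨⟨⟨z₁, z₂⟩, z₃⟩, ⟨⟨h₁, h₂⟩, h₃⟩, h⟩
      cases (show (z₁, z₂, z₃) = (y₁, y₂, y₃) from h)
      exact ⟨(x₁, x₂, x₃), rfl, h₁, h₂, h₃⟩
    · rintro ⟨⟨z₁, z₂, z₃⟩, h, h₁, h₂, h₃⟩
      cases (show (x₁, x₂, x₃) = (z₁, z₂, z₃) from h)
      exact ⟨((y₁, y₂), y₃), ⟨⟨h₁, h₂⟩, h₃⟩, rfl⟩
  leftUnitor_naturality r := by
    ext ⟨⟨u, x⟩, y⟩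
    constructor
    · rintro ⟨⟨u', z⟩, ⟨_, h⟩, h'⟩
      cases (show z = y from h')
      exact ⟨x, rfl, h⟩
    · rintro ⟨z, h', h⟩
      cases (show x = z from h')
      exact ⟨(u, y), ⟨rfl, h⟩, rfl⟩
  rightUnitor_naturality r := by
    ext ⟨⟨x, u⟩, y⟩
    constructor
    · rintro ⟨⟨z, u'⟩, ⟨h, _⟩, h'⟩
      cases (show z = y from h')
      exact ⟨x, rfl, h⟩
    · rintro ⟨z, h', h⟩
      cases (show x = z from h')
      exact ⟨(y, u), ⟨h, rfl⟩, rfl⟩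
  pentagon W X Y Z := by
    ext ⟨⟨⟨⟨w, x⟩, y⟩, z⟩, ⟨w', x', y', z'⟩⟩
    constructor
    · rintro ⟨⟨⟨a₁, a₂, a₃⟩, a₄⟩, ⟨h₁, h₂⟩, ⟨⟨b₁, ⟨b₂, b₃⟩, b₄⟩, h₃, ⟨h₄, h₅⟩⟩⟩
      cases (show (w, x, y) = (a₁, a₂, a₃) from h₁)
      cases (show z = a₄ from h₂)
      cases (show (w, (x, y), z) = (b₁, (b₂, b₃), b₄) from h₃)
      cases (show w = w' from h₄)
      cases (show (x, y, z) = (x', y', z') from h₅)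
      exact ⟨((w, x), y, z), rfl, rfl⟩
    · rintro ⟨⟨⟨a₁, a₂⟩, a₃, a₄⟩, h₁, h₂⟩
      cases (show ((w, x), y, z) = ((a₁, a₂), a₃, a₄) from h₁)
      cases (show (w, x, y, z) = (w', x', y', z') from h₂)
      exact ⟨((w, x, y), z), ⟨rfl, rfl⟩, ⟨(w, (x, y), z), rfl, ⟨rfl, rfl⟩⟩⟩
  triangle X Y := by
    ext ⟨⟨⟨x, u⟩, y⟩, ⟨x', y'⟩⟩
    constructor
    · rintro ⟨⟨a, b, c⟩, h₁, h₂, h₃⟩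
      cases (show (x, u, y) = (a, b, c) from h₁)
      exact ⟨h₂, h₃⟩
    · rintro ⟨h₁, h₂⟩
      exact ⟨(x, u, y), rfl, h₁, h₂⟩

/-- The braiding of the category of relations is the swap `(x, y) ↦ (y, x)`. -/
instance RelCat.instSymmetricCategory : SymmetricCategory RelCat.{v} where
  braiding X Y := RelCat.isoOfEquiv (Equiv.prodComm X Y)
  braiding_naturality_right X {Y Z} r := by
    ext ⟨⟨x, y⟩, ⟨z, x'⟩⟩
    constructor
    · rintro ⟨⟨a, b⟩, ⟨h₁, h₂⟩, h₃⟩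
      cases (show x = a from h₁)
      cases (show (b, x) = (z, x') from h₃)
      exact ⟨(y, x), rfl, h₂, rfl⟩
    · rintro ⟨⟨a, b⟩, h₁, h₂, h₃⟩
      cases (show (y, x) = (a, b) from h₁)
      cases (show x = x' from h₃)
      exact ⟨(x, z), ⟨rfl, h₂⟩, rfl⟩
  braiding_naturality_left {X Y} r Z := by
    ext ⟨⟨x, z⟩, ⟨z', y⟩⟩
    constructor
    · rintro ⟨⟨a, b⟩, ⟨h₁, h₂⟩, h₃⟩
      cases (show z = b from h₂)
      cases (show (z, a) = (z', y) from h₃)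
      exact ⟨(z, x), rfl, rfl, h₁⟩
    · rintro ⟨⟨a, b⟩, h₁, h₂, h₃⟩
      cases (show (z, x) = (a, b) from h₁)
      cases (show z = z' from h₂)
      exact ⟨(y, z), ⟨h₃, rfl⟩, rfl⟩
  hexagon_forward X Y Z := by
    ext ⟨⟨⟨x, y⟩, z⟩, ⟨y', z', x'⟩⟩
    constructor
    · rintro ⟨⟨a, b, c⟩, h₁, ⟨⟨⟨d, e⟩, f⟩, h₂, h₃⟩⟩
      cases (show (x, y, z) = (a, b, c) from h₁)
      cases (show ((y, z), x) = ((d, e), f) from h₂)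
      cases (show (y, z, x) = (y', z', x') from h₃)
      exact ⟨((y, x), z), ⟨rfl, rfl⟩, ⟨(y, x, z), rfl, ⟨rfl, rfl⟩⟩⟩
    · rintro ⟨⟨⟨a, b⟩, c⟩, ⟨h₁, h₂⟩, ⟨⟨d, e, f⟩, h₃, ⟨h₄, h₅⟩⟩⟩
      cases (show (y, x) = (a, b) from h₁)
      cases (show z = c from h₂)
      cases (show (y, x, z) = (d, e, f) from h₃)
      cases (show y = y' from h₄)
      cases (show (z, x) = (z', x') from h₅)
      exact ⟨(x, y, z), rfl, ⟨((y, z), x), rfl, rfl⟩⟩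
  hexagon_reverse X Y Z := by
    ext ⟨⟨x, y, z⟩, ⟨⟨z', x'⟩, y'⟩⟩
    constructor
    · rintro ⟨⟨⟨a, b⟩, c⟩, h₁, ⟨⟨d, e, f⟩, h₂, h₃⟩⟩
      cases (show ((a, b), c) = ((x, y), z) from (Equiv.prodAssoc X Y Z).injective h₁)
      cases (show (z, x, y) = (d, e, f) from h₂)
      cases (show ((z', x'), y') = ((z, x), y) from (Equiv.prodAssoc Z X Y).injective h₃)
      exact ⟨(x, z, y), ⟨rfl, rfl⟩, ⟨((x, z), y), rfl, ⟨rfl, rfl⟩⟩⟩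
    · rintro ⟨⟨a, b, c⟩, ⟨h₁, h₂⟩, ⟨⟨⟨d, e⟩, f⟩, h₃, ⟨h₄, h₅⟩⟩⟩
      cases (show x = a from h₁)
      cases (show (z, y) = (b, c) from h₂)
      cases (show ((d, e), f) = ((x, z), y) from (Equiv.prodAssoc X Z Y).injective h₃)
      cases (show (z, x) = (z', x') from h₄)
      cases (show y = y' from h₅)
      exact ⟨((x, y), z), rfl, ⟨(z, x, y), rfl, rfl⟩⟩
  symmetry X Y := by
    ext ⟨⟨x, y⟩, ⟨x', y'⟩⟩
    constructor
    · rintro ⟨⟨a, b⟩, h₁, h₂⟩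
      cases (show (y, x) = (a, b) from h₁)
      cases (show (x, y) = (x', y') from h₂)
      rfl
    · intro h
      cases (show (x, y) = (x', y') from h)
      exact ⟨(y, x), rfl, rfl⟩

end Rel

/-- The functor `E` is a strong symmetric monoidal dagger equivalence, where the unit comparison is
`* ↦ 1`, the tensor comparison is `(x, y) ↦ x ⊗ y`, and both consist of dagger isomorphisms. -/
structure IsAtomMonoidalDaggerEquivalence {C : Type u} [Category.{v} C] [DaggerCategory C]
    [HasZeroMorphisms C] [MonoidalCategory C] [SymmetricCategory C]
    (h : HasDaggerBiproducts C) (hE : AtomFunctorial h) : Prop where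
  daggerEquivalence : IsDaggerEquivalence (atomFunctor h hE)
  monoidal : ∃ B : (atomFunctor h hE).Braided,
    B.ε = RelCat.Hom.ofRel {p : 𝟙_ RelCat.{v} × AtomObj h (𝟙_ C) | p.2.mor = 𝟙 (𝟙_ C)} ∧
    IsDaggerIso B.ε ∧
    (∀ X Y : C, B.μ X Y = RelCat.Hom.ofRel
      {p : (AtomObj h X × AtomObj h Y) × AtomObj h (X ⊗ Y) |
        p.2.mor = (λ_ (𝟙_ C)).inv ≫ (p.1.1.mor ⊗ₘ p.1.2.mor)}) ∧
    ∀ X Y : C, IsDaggerIso (B.μ X Y)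

/-!
The sum `t` of countably many identities of `I` satisfies `t + t = t` and `t + 1 = t`, so it is
nonzero, hence invertible, and `1 + 1 = 1`. The sum of all scalars is nonzero and fixed by every
nonzero scalar, so `0` and `1` are the only scalars. As `I` is a separator, a morphism `r` is then
determined by the pairs of points `x`, `y` with `y‡ ∘ r ∘ x = 1`. Dagger kernels show that two
points meet, i.e. `v‡ ∘ u = 1`, exactly when some nonzero point lies below both, so that the points
of an object are ordered like subsets and have complements. Currying transfers the complements to
all morphisms; let `n` be the complement of `1 : X ⟶ X`. If no atom lay below a nonzero point `x`,
then `n` would relate any two nonzero points below `x`, so the projection onto the support of `x`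
would lie below both `1` and `n`, hence vanish.

The atoms of `X` therefore form an orthonormal basis of points, and the atoms are the members of any
such basis. Morphisms are determined by their matrices of scalars in these bases, so that `E` is a
full and faithful dagger functor. The points `x ⊗ y`, for `x` and `y` in two bases, are a basis of
the tensor product, which gives the monoidal comparison, and the injections of a dagger biproduct of
`M` copies of `I` are a basis indexed by `M`, which gives essential surjectivity.
-/

attribute [simp] DaggerCategory.dagger_id DaggerCategory.dagger_dagger DaggerCategory.dagger_comp

section Dagger

variable {C : Type u} [Category.{v} C] [DaggerCategory C]

theorem dagger_injective {X Y : C} {f g : X ⟶ Y} (h : f‡ = g‡) : f = g := by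
  rw [← DaggerCategory.dagger_dagger f, h, DaggerCategory.dagger_dagger]

theorem IsDaggerMono.mono {X Y : C} {m : X ⟶ Y} (hm : IsDaggerMono m) : Mono m :=
  (SplitMono.mk (m‡) hm).mono

theorem IsDaggerIso.dagger_inv {X Y : C} {e : X ≅ Y} (he : IsDaggerIso e.hom) :
    (e.inv)‡ = e.hom :=
  dagger_injective <| by
    rw [DaggerCategory.dagger_dagger, ← cancel_epi e.hom, e.hom_inv_id, he.1]

@[simp]
theorem dagger_zero [HasZeroMorphisms C] (X Y : C) : (0 : X ⟶ Y)‡ = 0 :=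
  calc (0 : X ⟶ Y)‡ = ((0 : Y ⟶ X)‡ ≫ (0 : Y ⟶ Y))‡ := by rw [comp_zero]
    _ = 0 := by rw [DaggerCategory.dagger_comp, DaggerCategory.dagger_dagger, comp_zero]

theorem dagger_eq_zero_iff [HasZeroMorphisms C] {X Y : C} {f : X ⟶ Y} : f‡ = 0 ↔ f = 0 :=
  ⟨fun h => dagger_injective (h.trans (dagger_zero X Y).symm), fun h => by simp [h]⟩

end Dagger

namespace DaggerBiproduct

variable {C : Type u} [Category.{v} C] [DaggerCategory C] [HasZeroMorphisms C] {M : Type*}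

section

variable {f : M → C} (B : DaggerBiproduct f)

theorem hom_ext {W : C} {g g' : W ⟶ B.bicone.pt}
    (h : ∀ m, g ≫ B.bicone.π m = g' ≫ B.bicone.π m) : g = g' :=
  B.isBilimit.isLimit.hom_ext fun j => h j.as

theorem hom_ext_ι {W : C} {g g' : B.bicone.pt ⟶ W}
    (h : ∀ m, B.bicone.ι m ≫ g = B.bicone.ι m ≫ g') : g = g' :=
  B.isBilimit.isColimit.hom_ext fun j => h j.as

/-- The morphism into a dagger biproduct with prescribed components. -/
noncomputable def lift {W : C} (r : ∀ m, W ⟶ f m) : W ⟶ B.bicone.pt :=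
  B.isBilimit.isLimit.lift (Fan.mk W r)

@[simp]
theorem lift_π {W : C} (r : ∀ m, W ⟶ f m) (m : M) : B.lift r ≫ B.bicone.π m = r m :=
  B.isBilimit.isLimit.fac _ (Discrete.mk m)

theorem comp_lift {V W : C} (s : V ⟶ W) (r : ∀ m, W ⟶ f m) :
    s ≫ B.lift r = B.lift fun m => s ≫ r m :=
  B.hom_ext fun m => by simp

theorem map_π {g : M → C} (B' : DaggerBiproduct g) (s : ∀ m, f m ⟶ g m) (m : M) :
    B.map B' s ≫ B'.bicone.π m = B.bicone.π m ≫ s m :=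
  B'.lift_π _ m

theorem lift_map {W : C} {g : M → C} (B' : DaggerBiproduct g) (r : ∀ m, W ⟶ f m)
    (s : ∀ m, f m ⟶ g m) : B.lift r ≫ B.map B' s = B'.lift fun m => r m ≫ s m :=
  B'.hom_ext fun m => by
    rw [Category.assoc, map_π, ← Category.assoc, lift_π, lift_π]

theorem lift_eq_comp_ι {W : C} (r : ∀ m, W ⟶ f m) {j : M} (hr : ∀ m, m ≠ j → r m = 0) :
    B.lift r = r j ≫ B.bicone.ι j :=
  B.hom_ext fun m => by
    obtain rfl | hm := eq_or_ne m j
    · simp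
    · simp [hr m hm, hm.symm]

theorem ι_map {g : M → C} (B' : DaggerBiproduct g) (s : ∀ m, f m ⟶ g m) (m : M) :
    B.bicone.ι m ≫ B.map B' s = s m ≫ B'.bicone.ι m :=
  B'.hom_ext fun n => by
    rw [Category.assoc, map_π]
    obtain rfl | hmn := eq_or_ne m n
    · simp
    · simp [hmn]

theorem ι_eq (m : M) : B.bicone.ι m = (B.bicone.π m)‡ := by
  rw [B.π_eq, DaggerCategory.dagger_dagger]

/-- The dagger biproduct given by a bicone with `π = ι‡` that is a colimit: the universal property
of the product is the image under the dagger of that of the coproduct. -/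
def ofIsColimit (b : Bicone f) (hb : IsColimit b.toCocone) (hπ : ∀ m, b.π m = (b.ι m)‡) :
    DaggerBiproduct f where
  bicone := b
  isBilimit :=
    let desc (s : Fan f) : b.pt ⟶ s.pt := hb.desc (Cofan.mk s.pt fun m => (s.proj m)‡)
    have ι_desc (s : Fan f) (m : M) : b.ι m ≫ desc s = (s.proj m)‡ := hb.fac _ (Discrete.mk m)
    { isLimit := Fan.IsLimit.mk _ (fun s => (desc s)‡)
        (fun s m => dagger_injective <| by
          change ((desc s)‡ ≫ b.π m)‡ = (s.proj m)‡
          rw [← ι_desc, hπ, DaggerCategory.dagger_comp, DaggerCategory.dagger_dagger,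
            DaggerCategory.dagger_dagger])
        (fun s (g : s.pt ⟶ b.pt) (hg : ∀ m, g ≫ b.π m = s.proj m) =>
          dagger_injective <| hb.hom_ext fun ⟨m⟩ => by
            change b.ι m ≫ g‡ = b.ι m ≫ (desc s)‡‡
            rw [DaggerCategory.dagger_dagger, ι_desc, ← hg, DaggerCategory.dagger_comp, hπ,
              DaggerCategory.dagger_dagger])
      isColimit := hb }
  π_eq := hπ

end

section

variable {Y : C} (B : DaggerBiproduct fun _ : M => Y)

theorem diag_π (m : M) : B.diag ≫ B.bicone.π m = 𝟙 Y := B.lift_π _ m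

theorem ι_codiag (m : M) : B.bicone.ι m ≫ (B.diag)‡ = 𝟙 Y := by
  rw [B.ι_eq, ← DaggerCategory.dagger_comp, diag_π, DaggerCategory.dagger_id]

theorem diag_map {g : M → C} (B' : DaggerBiproduct g) (s : ∀ m, Y ⟶ g m) :
    B.diag ≫ B.map B' s = B'.lift s :=
  (B.lift_map B' _ s).trans (by simp)

theorem codiag_comp {Z : C} (B' : DaggerBiproduct fun _ : M => Z) (s : Y ⟶ Z) :
    (B.diag)‡ ≫ s = B.map B' (fun _ => s) ≫ (B'.diag)‡ := by
  refine B.hom_ext_ι fun m => ?_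
  rw [← Category.assoc, B.ι_codiag, ← Category.assoc, ι_map, Category.assoc, B'.ι_codiag,
    Category.id_comp, Category.comp_id]

end

end DaggerBiproduct

/-! ### Sums of morphisms -/

section Sums

variable {C : Type u} [Category.{v} C] [DaggerCategory C] [HasZeroMorphisms C]
  (h : HasDaggerBiproducts C)

theorem homSum_eq_lift {M : Type v} {X Y : C} (r : M → (X ⟶ Y)) :
    homSum h r = (h M fun _ => Y).some.lift r ≫ ((h M fun _ => Y).some.diag)‡ := by
  rw [homSum, ← Category.assoc, DaggerBiproduct.diag_map]

theorem comp_homSum {M : Type v} {W X Y : C} (s : W ⟶ X) (r : M → (X ⟶ Y)) :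
    s ≫ homSum h r = homSum h fun m => s ≫ r m := by
  rw [homSum_eq_lift, homSum_eq_lift, ← Category.assoc, DaggerBiproduct.comp_lift]

theorem homSum_comp {M : Type v} {X Y Z : C} (r : M → (X ⟶ Y)) (s : Y ⟶ Z) :
    homSum h r ≫ s = homSum h fun m => r m ≫ s := by
  rw [homSum_eq_lift, homSum_eq_lift, Category.assoc,
    DaggerBiproduct.codiag_comp _ (h M fun _ => Z).some, ← Category.assoc,
    DaggerBiproduct.lift_map]

theorem homSum_single {M : Type v} {X Y : C} (r : M → (X ⟶ Y)) (j : M)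
    (hr : ∀ m, m ≠ j → r m = 0) : homSum h r = r j := by
  rw [homSum_eq_lift, DaggerBiproduct.lift_eq_comp_ι _ r hr, Category.assoc,
    DaggerBiproduct.ι_codiag, Category.comp_id]

theorem homSum_ite_eq {M : Type v} [DecidableEq M] {X Y : C} (r : M → (X ⟶ Y)) (j : M) :
    homSum h (fun m => if j = m then r m else 0) = r j := by
  rw [homSum_single h _ j fun m hm => if_neg hm.symm, if_pos rfl]

theorem homSum_zero (M : Type v) (X Y : C) : homSum h (fun _ : M => (0 : X ⟶ Y)) = 0 := by
  simpa using (comp_homSum h (0 : X ⟶ Y) fun _ : M => 𝟙 Y).symm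

theorem homSum_comm {M N : Type v} {X Y : C} (r : M → N → (X ⟶ Y)) :
    homSum h (fun m => homSum h (r m)) = homSum h fun n => homSum h fun m => r m n := by
  have lift_homSum : homSum h (fun m => (h N fun _ => Y).some.lift (r m)) =
      (h N fun _ => Y).some.lift fun n => homSum h fun m => r m n :=
    DaggerBiproduct.hom_ext _ fun n => by simp [homSum_comp]
  rw [homSum_eq_lift h fun n => homSum h fun m => r m n, ← lift_homSum, homSum_comp]
  simp_rw [homSum_eq_lift h (r _)]

theorem homSum_comp_injective {M N : Type v} {i : M → N} (hi : i.Injective) {X Y : C}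
    {r : N → (X ⟶ Y)} (hr : ∀ n, n ∉ Set.range i → r n = 0) :
    homSum h (fun m => r (i m)) = homSum h r := by
  classical
  calc homSum h (fun m => r (i m))
      = homSum h fun m => homSum h fun n => if i m = n then r n else 0 := by
        simp_rw [homSum_ite_eq]
    _ = homSum h fun n => homSum h fun m => if i m = n then r n else 0 := homSum_comm h _
    _ = homSum h r := by
        congr! 2 with n
        by_cases hn : n ∈ Set.range i
        · obtain ⟨m, rfl⟩ := hn
          simp_rw [hi.eq_iff, eq_comm (b := m)]
          exact homSum_ite_eq h (fun _ => r (i m)) m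
        · simp [hr n hn, homSum_zero]

theorem homSum_equiv {M N : Type v} (e : M ≃ N) {X Y : C} (r : N → (X ⟶ Y)) :
    homSum h (fun m => r (e m)) = homSum h r :=
  homSum_comp_injective h e.injective fun n hn => (hn (e.surjective n)).elim

theorem comp_homAdd {W X Y : C} (t : W ⟶ X) (r s : X ⟶ Y) :
    t ≫ homAdd h r s = homAdd h (t ≫ r) (t ≫ s) := by
  simp_rw [homAdd, comp_homSum, comp_ite]

theorem homAdd_comp {X Y Z : C} (r s : X ⟶ Y) (t : Y ⟶ Z) :
    homAdd h r s ≫ t = homAdd h (r ≫ t) (s ≫ t) := by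
  simp_rw [homAdd, homSum_comp, ite_comp]

theorem homSum_homAdd {M : Type v} {X Y : C} (r s : M → (X ⟶ Y)) :
    homSum h (fun m => homAdd h (r m) (s m)) = homAdd h (homSum h r) (homSum h s) := by
  simp_rw [homAdd]
  rw [homSum_comm]
  congr! with b
  split_ifs <;> rfl

@[simp]
theorem homAdd_zero {X Y : C} (r : X ⟶ Y) : homAdd h r 0 = r :=
  homSum_single h (fun b : ULift.{v} Bool => if b.down then r else 0) ⟨true⟩ <| by
    rintro ⟨_ | _⟩ hb <;> simp_all

@[simp]
theorem zero_homAdd {X Y : C} (r : X ⟶ Y) : homAdd h 0 r = r :=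
  homSum_single h (fun b : ULift.{v} Bool => if b.down then 0 else r) ⟨false⟩ <| by
    rintro ⟨_ | _⟩ hb <;> simp_all

theorem homSum_sum {M N : Type v} {X Y : C} (r : M ⊕ N → (X ⟶ Y)) :
    homSum h r = homAdd h (homSum h fun m => r (.inl m)) (homSum h fun n => r (.inr n)) := by
  let rM : M ⊕ N → (X ⟶ Y) := Sum.elim (fun m => r (.inl m)) 0
  let rN : M ⊕ N → (X ⟶ Y) := Sum.elim 0 (fun n => r (.inr n))
  calc homSum h r = homSum h fun x => homAdd h (rM x) (rN x) := by
        congr! 2 with x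
        cases x <;> simp [rM, rN]
    _ = homAdd h (homSum h rM) (homSum h rN) := homSum_homAdd h rM rN
    _ = _ := by
        rw [← homSum_comp_injective h Sum.inl_injective (r := rM) (by simp [rM]),
          ← homSum_comp_injective h Sum.inr_injective (r := rN) (by simp [rN])]
        rfl

theorem homLE_homSum {M : Type v} {X Y : C} (hidem : ∀ r : X ⟶ Y, homAdd h r r = r)
    (r : M → (X ⟶ Y)) (j : M) : homLE h (r j) (homSum h r) := by
  classical
  rw [homLE, ← homSum_ite_eq h r j, ← homSum_homAdd]
  congr! 2 with m
  split_ifs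
  · exact hidem _
  · exact zero_homAdd h _

end Sums

/-! ### Scalars and points -/

section Scalars

variable {C : Type u} [Category.{v} C] [DaggerCategory C] [HasZeroMorphisms C]
  [MonoidalCategory C] (hC : RelAxioms C)

namespace RelAxioms

include hC

theorem id_unit_ne_zero : 𝟙 (𝟙_ C) ≠ 0 := fun h =>
  hC.unit_nonzero ((IsZero.iff_id_eq_zero _).2 h)

theorem homAdd_id_unit_self : homAdd hC.biproducts (𝟙 (𝟙_ C)) (𝟙 (𝟙_ C)) = 𝟙 (𝟙_ C) := by
  set h := hC.biproducts
  let t : 𝟙_ C ⟶ 𝟙_ C := homSum h fun _ : ULift.{v} ℕ => 𝟙 _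
  have add_self : homAdd h t t = t := by
    let e : ULift.{v} ℕ ⊕ ULift.{v} ℕ ≃ ULift.{v} ℕ :=
      (Equiv.sumCongr Equiv.ulift Equiv.ulift).trans
        (Equiv.natSumNatEquivNat.trans Equiv.ulift.symm)
    exact (homSum_sum h _).symm.trans (homSum_equiv h e fun _ => 𝟙 _)
  have add_one : homAdd h t (𝟙 _) = t := by
    let e : ULift.{v} ℕ ⊕ PUnit.{v + 1} ≃ ULift.{v} ℕ :=
      (Equiv.sumCongr Equiv.ulift (Equiv.refl _)).trans
        (Equiv.natSumPUnitEquivNat.trans Equiv.ulift.symm)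
    rw [← homSum_single h (fun _ : PUnit.{v + 1} => 𝟙 (𝟙_ C)) ⟨⟩ fun _ hm => (hm rfl).elim]
    exact (homSum_sum h fun _ => 𝟙 _).symm.trans (homSum_equiv h e fun _ => 𝟙 _)
  have t_ne_zero : t ≠ 0 := fun ht => hC.id_unit_ne_zero <| by
    rwa [ht, zero_homAdd] at add_one
  have := hC.scalar_invertible t t_ne_zero
  rw [← cancel_mono t, homAdd_comp, Category.id_comp, add_self]

theorem hom_ext {X Y : C} {f g : X ⟶ Y} (h : ∀ x : 𝟙_ C ⟶ X, x ≫ f = x ≫ g) : f = g :=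
  hC.separator.def f g h

theorem homAdd_self {X Y : C} (r : X ⟶ Y) : homAdd hC.biproducts r r = r :=
  hC.hom_ext fun x => by
    simpa only [homAdd_comp, comp_homAdd, Category.id_comp] using
      congrArg (· ≫ x ≫ r) hC.homAdd_id_unit_self

theorem homLE_homSum {M : Type v} {X Y : C} (r : M → (X ⟶ Y)) (j : M) :
    homLE hC.biproducts (r j) (homSum hC.biproducts r) :=
  _root_.homLE_homSum _ hC.homAdd_self r j

/-- The sum `u` of all scalars is nonzero, hence invertible, and multiplication by an invertible
scalar `s` permutes its summands, so that `u ≫ s = u`. -/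
theorem scalar_eq_id {s : 𝟙_ C ⟶ 𝟙_ C} (hs : s ≠ 0) : s = 𝟙 _ := by
  have := hC.scalar_invertible s hs
  let u : 𝟙_ C ⟶ 𝟙_ C := homSum hC.biproducts fun t => t
  have u_ne_zero : u ≠ 0 := fun hu => hC.id_unit_ne_zero <| by
    have one_le : homAdd hC.biproducts (𝟙 _) u = u := hC.homLE_homSum (fun t => t) (𝟙 _)
    rwa [hu, homAdd_zero] at one_le
  have u_comp : u ≫ s = u := by
    rw [homSum_comp]
    exact homSum_equiv hC.biproducts (asIso s).homToEquiv fun t => t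
  have := hC.scalar_invertible u u_ne_zero
  rw [← cancel_epi u, u_comp, Category.comp_id]

theorem scalar_ne_zero_iff {s : 𝟙_ C ⟶ 𝟙_ C} : s ≠ 0 ↔ s = 𝟙 _ :=
  ⟨hC.scalar_eq_id, fun h => h ▸ hC.id_unit_ne_zero⟩

theorem scalar_ext {s t : 𝟙_ C ⟶ 𝟙_ C} (h : s = 𝟙 _ ↔ t = 𝟙 _) : s = t := by
  rw [← hC.scalar_ne_zero_iff, ← hC.scalar_ne_zero_iff, not_iff_not] at h
  by_cases hs : s = 0
  · rw [hs, h.1 hs]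
  · rw [hC.scalar_eq_id hs, hC.scalar_eq_id (mt h.2 hs)]

theorem scalar_dagger (s : 𝟙_ C ⟶ 𝟙_ C) : s‡ = s := by
  by_cases hs : s = 0
  · rw [hs, dagger_zero]
  · rw [hC.scalar_eq_id hs, DaggerCategory.dagger_id]

theorem scalar_comp_eq_id_iff {s t : 𝟙_ C ⟶ 𝟙_ C} : s ≫ t = 𝟙 _ ↔ s = 𝟙 _ ∧ t = 𝟙 _ := by
  refine ⟨fun h => ?_, fun ⟨hs, ht⟩ => by rw [hs, ht, Category.comp_id]⟩
  rw [← hC.scalar_ne_zero_iff] at h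
  exact ⟨hC.scalar_eq_id fun hs => h (by rw [hs, zero_comp]),
    hC.scalar_eq_id fun ht => h (by rw [ht, comp_zero])⟩

theorem scalar_homSum_eq_id_iff {M : Type v} (s : M → (𝟙_ C ⟶ 𝟙_ C)) :
    homSum hC.biproducts s = 𝟙 _ ↔ ∃ m, s m = 𝟙 _ := by
  simp only [← hC.scalar_ne_zero_iff]
  constructor
  · contrapose!
    intro hs
    rw [funext hs]
    exact homSum_zero _ M _ _
  · rintro ⟨m, hm⟩ h
    have le := hC.homLE_homSum s m
    rw [homLE, h, homAdd_zero] at le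
    exact hm le

end RelAxioms

end Scalars

section Meets

variable {C : Type u} [Category.{v} C] [DaggerCategory C] [MonoidalCategory C]

/-- Two points `u`, `v` of `X`, i.e. morphisms `I ⟶ X`, meet if `v‡ ∘ u = 1`. Under the equivalence
with relations, points are subsets and meeting means having a common element. -/
def Meets {X : C} (u v : 𝟙_ C ⟶ X) : Prop := u ≫ v‡ = 𝟙 (𝟙_ C)

theorem meets_comp_iff {X Y : C} {x : 𝟙_ C ⟶ X} {r : X ⟶ Y} {y : 𝟙_ C ⟶ Y} :
    Meets (x ≫ r) y ↔ Meets x (y ≫ r‡) := by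
  simp [Meets]

variable [HasZeroMorphisms C] (hC : RelAxioms C)

namespace RelAxioms

include hC

theorem meets_comm {X : C} {u v : 𝟙_ C ⟶ X} : Meets u v ↔ Meets v u := by
  rw [Meets, Meets, ← hC.scalar_dagger (u ≫ v‡), DaggerCategory.dagger_comp,
    DaggerCategory.dagger_dagger]

theorem not_meets_iff {X : C} {u v : 𝟙_ C ⟶ X} : ¬ Meets u v ↔ u ≫ v‡ = 0 := by
  rw [Meets, ← hC.scalar_ne_zero_iff, not_not]

theorem not_meets_zero {X : C} (u : 𝟙_ C ⟶ X) : ¬ Meets u 0 :=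
  hC.not_meets_iff.2 (by rw [dagger_zero, comp_zero])

theorem hom_ext_meets {X Y : C} {r s : X ⟶ Y}
    (h : ∀ (x : 𝟙_ C ⟶ X) (y : 𝟙_ C ⟶ Y), Meets (x ≫ r) y ↔ Meets (x ≫ s) y) : r = s := by
  refine hC.hom_ext fun x => dagger_injective <| hC.hom_ext fun y => dagger_injective ?_
  simpa using hC.scalar_ext (h x y)

theorem meets_homSum_iff {M : Type v} {X : C} {u : M → (𝟙_ C ⟶ X)} {w : 𝟙_ C ⟶ X} :
    Meets (homSum hC.biproducts u) w ↔ ∃ m, Meets (u m) w := by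
  rw [Meets, homSum_comp, hC.scalar_homSum_eq_id_iff]
  rfl

theorem meets_homAdd_iff {X : C} {u v w : 𝟙_ C ⟶ X} :
    Meets (homAdd hC.biproducts u v) w ↔ Meets u w ∨ Meets v w := by
  rw [homAdd, hC.meets_homSum_iff, ULift.exists, Bool.exists_bool, or_comm]
  rfl

theorem homLE_iff {X Y : C} {r s : X ⟶ Y} : homLE hC.biproducts r s ↔
    ∀ (x : 𝟙_ C ⟶ X) (y : 𝟙_ C ⟶ Y), Meets (x ≫ r) y → Meets (x ≫ s) y := by
  have meets_homAdd (x : 𝟙_ C ⟶ X) (y : 𝟙_ C ⟶ Y) :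
      Meets (x ≫ homAdd hC.biproducts r s) y ↔ Meets (x ≫ r) y ∨ Meets (x ≫ s) y := by
    rw [comp_homAdd, hC.meets_homAdd_iff]
  refine ⟨fun h x y hr => ?_, fun h => hC.hom_ext_meets fun x y => ?_⟩
  · rw [← h, meets_homAdd]
    exact .inl hr
  · rw [meets_homAdd, or_iff_right_of_imp (h x y)]

theorem homLE_point_iff {X : C} {u v : 𝟙_ C ⟶ X} :
    homLE hC.biproducts u v ↔ ∀ w, Meets u w → Meets v w := by
  have meets_scalar_comp (s : 𝟙_ C ⟶ 𝟙_ C) (u w : 𝟙_ C ⟶ X) :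
      Meets (s ≫ u) w ↔ s = 𝟙 _ ∧ Meets u w := by
    rw [Meets, Category.assoc, hC.scalar_comp_eq_id_iff, Meets]
  simp only [hC.homLE_iff, meets_scalar_comp]
  exact ⟨fun h w hw => (h _ w ⟨rfl, hw⟩).2, fun h _ w hw => ⟨hw.1, h w hw.2⟩⟩

theorem homLE_antisymm {X Y : C} {r s : X ⟶ Y} (h₁ : homLE hC.biproducts r s)
    (h₂ : homLE hC.biproducts s r) : r = s :=
  hC.hom_ext_meets fun x y => ⟨hC.homLE_iff.1 h₁ x y, hC.homLE_iff.1 h₂ x y⟩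

theorem meets_mono_left {X : C} {u v w : 𝟙_ C ⟶ X} (huv : homLE hC.biproducts u v)
    (h : Meets u w) : Meets v w :=
  hC.homLE_point_iff.1 huv w h

theorem meets_mono_right {X : C} {u v w : 𝟙_ C ⟶ X} (huv : homLE hC.biproducts u v)
    (h : Meets w u) : Meets w v :=
  hC.meets_comm.1 (hC.meets_mono_left huv (hC.meets_comm.1 h))

end RelAxioms

end Meets

section Tensor

variable {C : Type u} [Category.{v} C] [HasZeroMorphisms C] [MonoidalCategory C]

theorem whiskerLeft_zero_of_closed (X Y Z : C) [Closed X] :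
    X ◁ (0 : Y ⟶ Z) = 0 :=
  (tensorLeft X).map_zero Y Z

variable [DaggerCategory C]

theorem DaggerBiproduct.whiskerLeft_hom_ext {M : Type*} {f : M → C} (B : DaggerBiproduct f)
    (X : C) [Closed X] {Z : C} {g g' : X ⊗ B.bicone.pt ⟶ Z}
    (h : ∀ m, X ◁ B.bicone.ι m ≫ g = X ◁ B.bicone.ι m ≫ g') : g = g' :=
  (isColimitOfPreserves (tensorLeft X) B.isBilimit.isColimit).hom_ext fun j => h j.as

variable (h : HasDaggerBiproducts C)

theorem whiskerLeft_homSum {M : Type v} (X : C) [Closed X] {Y Z : C} (r : M → (Y ⟶ Z)) :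
    X ◁ homSum h r = homSum h fun m => X ◁ r m := by
  set B := (h M fun _ => Z).some with hB
  have whiskerLeft_codiag : X ◁ (B.diag)‡ = homSum h fun m => X ◁ B.bicone.π m :=
    B.whiskerLeft_hom_ext X fun j => by
      rw [← whiskerLeft_comp, B.ι_codiag, comp_homSum, homSum_single h _ j]
      · simp [← whiskerLeft_comp]
      · intro m hm
        simp [← whiskerLeft_comp, hm.symm, whiskerLeft_zero_of_closed]
  rw [homSum_eq_lift, ← hB, whiskerLeft_comp, whiskerLeft_codiag, comp_homSum]
  simp [← whiskerLeft_comp]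

theorem whiskerLeft_homAdd (X : C) [Closed X] {Y Z : C} (r s : Y ⟶ Z) :
    X ◁ homAdd h r s = homAdd h (X ◁ r) (X ◁ s) := by
  simp_rw [homAdd, whiskerLeft_homSum, apply_ite]

theorem homSum_whiskerRight [BraidedCategory C] {M : Type v} {Y Z : C} (r : M → (Y ⟶ Z)) (X : C)
    [Closed X] : homSum h r ▷ X = homSum h fun m => r m ▷ X := by
  have whiskerRight_eq (f : Y ⟶ Z) : f ▷ X = (β_ Y X).hom ≫ X ◁ f ≫ (β_ Z X).inv := by simp
  simp_rw [whiskerRight_eq, whiskerLeft_homSum, homSum_comp, comp_homSum]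

theorem uncurry'_homAdd {X Y : C} [Closed X] (u v : 𝟙_ C ⟶ (ihom X).obj Y) :
    MonoidalClosed.uncurry' (homAdd h u v) =
      homAdd h (MonoidalClosed.uncurry' u) (MonoidalClosed.uncurry' v) := by
  simp_rw [MonoidalClosed.uncurry', MonoidalClosed.uncurry_eq, whiskerLeft_homAdd, homAdd_comp,
    comp_homAdd]

end Tensor

section Kernels

variable {C : Type u} [Category.{v} C] [HasZeroMorphisms C]

theorem IsKernelOf.condition {A X Y : C} {k : A ⟶ X} {f : X ⟶ Y} (hk : IsKernelOf k f) :
    k ≫ f = 0 := hk.1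

theorem IsKernelOf.exists_fac {A X Y W : C} {k : A ⟶ X} {f : X ⟶ Y} (hk : IsKernelOf k f)
    (g : W ⟶ X) (hg : g ≫ f = 0) : ∃ l, l ≫ k = g := by
  obtain ⟨w, ⟨hl⟩⟩ := hk
  obtain ⟨l, hl⟩ := KernelFork.IsLimit.lift' hl g hg
  exact ⟨l, hl⟩

variable [DaggerCategory C]

theorem comp_dagger_eq_zero_comm {X Y Z : C} {f : X ⟶ Z} {g : Y ⟶ Z} :
    f ≫ g‡ = 0 ↔ g ≫ f‡ = 0 := by
  rw [← dagger_eq_zero_iff, DaggerCategory.dagger_comp, DaggerCategory.dagger_dagger]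

variable (h : HasDaggerBiproducts C)

theorem comp_homLE_comp {W X Y : C} {r s : X ⟶ Y} (hrs : homLE h r s) (t : W ⟶ X) :
    homLE h (t ≫ r) (t ≫ s) := by
  rw [homLE, ← comp_homAdd, hrs]

theorem homLE_comp {X Y Z : C} {r s : X ⟶ Y} (hrs : homLE h r s) (t : Y ⟶ Z) :
    homLE h (r ≫ t) (s ≫ t) := by
  rw [homLE, ← homAdd_comp, hrs]

theorem homAdd_dagger_comp_self_eq_id {A A' X : C} {k : A ⟶ X} {k' : A' ⟶ X} (hk : IsDaggerMono k)
    (hk' : IsDaggerMono k') (horth : k' ≫ k‡ = 0) (hepi : JointlyEpic k k') :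
    homAdd h (k‡ ≫ k) (k'‡ ≫ k') = 𝟙 X := by
  refine hepi _ _ ?_ ?_
  · rw [comp_homAdd, reassoc_of% hk, reassoc_of% comp_dagger_eq_zero_comm.1 horth, zero_comp,
      homAdd_zero, Category.comp_id]
  · rw [comp_homAdd, reassoc_of% hk', reassoc_of% horth, zero_comp, zero_homAdd,
      Category.comp_id]

end Kernels

/-! ### Complements and atoms -/

section Boolean

variable {C : Type u} [Category.{v} C] [DaggerCategory C] [HasZeroMorphisms C]

/-- `n` is a complement of `r` in the ordered set of morphisms `X ⟶ Y`: their sum is the greatest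
element, and only zero lies below both. -/
structure IsHomCompl (h : HasDaggerBiproducts C) {X Y : C} (r n : X ⟶ Y) : Prop where
  le_homAdd : ∀ t, homLE h t (homAdd h r n)
  eq_zero_of_le : ∀ q, homLE h q r → homLE h q n → q = 0

variable [MonoidalCategory C] (hC : RelAxioms C)

namespace RelAxioms

include hC

theorem ne_zero_of_meets_right {X : C} {u v : 𝟙_ C ⟶ X} (h : Meets u v) : v ≠ 0 := by
  rintro rfl
  exact hC.not_meets_zero u h

theorem ne_zero_of_meets_left {X : C} {u v : 𝟙_ C ⟶ X} (h : Meets u v) : u ≠ 0 :=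
  hC.ne_zero_of_meets_right (hC.meets_comm.1 h)

theorem meets_self_iff {X : C} {z : 𝟙_ C ⟶ X} : Meets z z ↔ z ≠ 0 := by
  refine ⟨hC.ne_zero_of_meets_right, fun hz => ?_⟩
  by_contra hzz
  obtain ⟨A, k, hk, hk_mono⟩ := hC.kernels (z‡)
  obtain ⟨l, rfl⟩ := hk.exists_fac z (hC.not_meets_iff.1 hzz)
  have l_eq_zero : l = 0 := by
    have := comp_dagger_eq_zero_comm.1 hk.condition
    rwa [Category.assoc, hk_mono, Category.comp_id] at this
  exact hz (by rw [l_eq_zero, zero_comp])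

/-- The projection onto the support of a point `x`, namely onto `(ker x‡)^⊥`. -/
theorem exists_support {X : C} (x : 𝟙_ C ⟶ X) :
    ∃ q : X ⟶ X, q‡ = q ∧ homLE hC.biproducts q (𝟙 X) ∧ x ≫ q = x ∧
      ∀ u : 𝟙_ C ⟶ X, homLE hC.biproducts (u ≫ q) x := by
  obtain ⟨A, k, hk, hk_mono⟩ := hC.kernels (x‡)
  obtain ⟨A', k', hk', hk'_mono⟩ := hC.kernels (k‡)
  have id_eq : homAdd hC.biproducts (k‡ ≫ k) (k'‡ ≫ k') = 𝟙 X :=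
    homAdd_dagger_comp_self_eq_id _ hk_mono hk'_mono hk'.condition
      (hC.jointlyEpic k k' ⟨hk_mono, _, _, hk⟩ ⟨hk'_mono, hk'⟩)
  have selfAdjoint : (k'‡ ≫ k')‡ = k'‡ ≫ k' := by simp
  have k_comp : k ≫ k'‡ ≫ k' = 0 := by
    rw [reassoc_of% comp_dagger_eq_zero_comm.1 hk'.condition, zero_comp]
  refine ⟨k'‡ ≫ k', selfAdjoint, ?_, ?_, fun u => hC.homLE_point_iff.2 fun w hw => ?_⟩
  · rw [← id_eq]
    exact hC.homLE_iff.2 fun y w hw => by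
      rw [comp_homAdd, hC.meets_homAdd_iff]
      exact .inr hw
  · have := congrArg (x ≫ ·) id_eq
    simpa only [comp_homAdd, reassoc_of% comp_dagger_eq_zero_comm.1 hk.condition, zero_comp,
      zero_homAdd, Category.comp_id] using this
  · by_contra hxw
    obtain ⟨l, rfl⟩ := hk.exists_fac w (comp_dagger_eq_zero_comm.1 (hC.not_meets_iff.1 hxw))
    rw [meets_comp_iff, selfAdjoint, Category.assoc, k_comp, comp_zero] at hw
    exact hC.not_meets_zero u hw

theorem meets_iff_exists_homLE {X : C} {u v : 𝟙_ C ⟶ X} : Meets u v ↔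
    ∃ z, z ≠ 0 ∧ homLE hC.biproducts z u ∧ homLE hC.biproducts z v := by
  refine ⟨fun h => ?_, fun ⟨z, hz, hzu, hzv⟩ =>
    hC.meets_mono_left hzu (hC.meets_mono_right hzv (hC.meets_self_iff.2 hz))⟩
  obtain ⟨q, q_dagger, q_le, u_comp_q, comp_q_le⟩ := hC.exists_support u
  refine ⟨v ≫ q, hC.ne_zero_of_meets_right (u := u) ?_, comp_q_le v, ?_⟩
  · rwa [← q_dagger, ← meets_comp_iff, u_comp_q]
  · simpa only [Category.comp_id] using comp_homLE_comp _ q_le v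

theorem exists_isHomCompl_point {X : C} (x : 𝟙_ C ⟶ X) :
    ∃ n, IsHomCompl hC.biproducts x n := by
  let n : 𝟙_ C ⟶ X := homSum hC.biproducts fun y : {y : 𝟙_ C ⟶ X // ¬ Meets x y} => y.1
  refine ⟨n, fun t => hC.homLE_point_iff.2 fun w hw => hC.meets_homAdd_iff.2 ?_,
    fun q hqx hqn => ?_⟩
  · refine or_iff_not_imp_left.2 fun hxw => hC.meets_homSum_iff.2 ⟨⟨w, hxw⟩, ?_⟩
    exact hC.meets_self_iff.2 (hC.ne_zero_of_meets_right hw)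
  · by_contra hq
    obtain ⟨⟨y, hxy⟩, hy⟩ := hC.meets_homSum_iff.1
      (hC.meets_comm.1 (hC.meets_iff_exists_homLE.2 ⟨q, hq, hqx, hqn⟩))
    exact hxy (hC.meets_comm.1 hy)

/-- Currying identifies the ordered set of morphisms `X ⟶ Y` with that of points of the internal
hom, where a complement is the sum of all disjoint points. -/
theorem exists_isHomCompl {X Y : C} [Closed X] (r : X ⟶ Y) :
    ∃ n, IsHomCompl hC.biproducts r n := by
  let e : (𝟙_ C ⟶ (ihom X).obj Y) ≃ (X ⟶ Y) := MonoidalClosed.curryHomEquiv'.symm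
  have map_homAdd (u v) : e (homAdd hC.biproducts u v) = homAdd hC.biproducts (e u) (e v) :=
    uncurry'_homAdd _ u v
  have homLE_iff_homLE (u v) :
      homLE hC.biproducts (e u) (e v) ↔ homLE hC.biproducts u v := by
    rw [homLE, ← map_homAdd, e.apply_eq_iff_eq, homLE]
  have map_zero : e 0 = 0 := by
    simp [e, MonoidalClosed.uncurry', MonoidalClosed.uncurry_eq, whiskerLeft_zero_of_closed]
  obtain ⟨x, rfl⟩ := e.surjective r
  obtain ⟨n, hn⟩ := hC.exists_isHomCompl_point x
  refine ⟨e n, e.surjective.forall.2 fun t => ?_, e.surjective.forall.2 fun q hqx hqn => ?_⟩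
  · rw [← map_homAdd, homLE_iff_homLE]
    exact hn.le_homAdd t
  · rw [homLE_iff_homLE] at hqx hqn
    rw [hn.eq_zero_of_le q hqx hqn, map_zero]

theorem meets_comp_of_isHomCompl_id {X : C} {n : X ⟶ X} (hn : IsHomCompl hC.biproducts (𝟙 X) n)
    {b y : 𝟙_ C ⟶ X} (hb : b ≠ 0) (hy : y ≠ 0) (hby : ¬ Meets b y) : Meets (b ≫ n) y := by
  have meets_top : Meets (b ≫ b‡ ≫ y) y := by
    rw [← Category.assoc, hC.meets_self_iff.2 hb, Category.id_comp]
    exact hC.meets_self_iff.2 hy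
  have := hC.homLE_iff.1 (hn.le_homAdd (b‡ ≫ y)) b y meets_top
  rw [comp_homAdd, Category.comp_id, hC.meets_homAdd_iff] at this
  exact this.resolve_left hby

theorem exists_not_meets_of_not_isHomAtom {X : C} {z : 𝟙_ C ⟶ X} (hz : z ≠ 0)
    (hatom : ¬ IsHomAtom hC.biproducts z) : ∃ b c, b ≠ 0 ∧ c ≠ 0 ∧
      homLE hC.biproducts b z ∧ homLE hC.biproducts c z ∧ ¬ Meets b c := by
  obtain ⟨b, hbz, hb, hb_ne⟩ : ∃ b, homLE hC.biproducts b z ∧ b ≠ 0 ∧ b ≠ z := by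
    simpa [IsHomAtom, hz] using hatom
  obtain ⟨u, hzu, hbu⟩ : ∃ u, Meets z u ∧ ¬ Meets b u := by
    by_contra! h
    exact hb_ne (hC.homLE_antisymm hbz (hC.homLE_point_iff.2 h))
  obtain ⟨c, hc, hcz, hcu⟩ := hC.meets_iff_exists_homLE.1 hzu
  exact ⟨b, c, hb, hc, hbz, hcz, fun hbc => hbu (hC.meets_mono_right hcu hbc)⟩

theorem meets_comp_of_not_isHomAtom {X : C} {n : X ⟶ X} (hn : IsHomCompl hC.biproducts (𝟙 X) n)
    {z w : 𝟙_ C ⟶ X} (hz : z ≠ 0) (hatom : ¬ IsHomAtom hC.biproducts z) (hw : w ≠ 0) :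
    Meets (z ≫ n) w := by
  obtain ⟨b, c, hb, hc, hbz, hcz, hbc⟩ := hC.exists_not_meets_of_not_isHomAtom hz hatom
  by_cases hbw : Meets b w
  · obtain ⟨y, hy, hyb, hyw⟩ := hC.meets_iff_exists_homLE.1 hbw
    have hcy : ¬ Meets c y := fun h => hbc (hC.meets_mono_left hyb (hC.meets_comm.1 h))
    exact hC.meets_mono_left (homLE_comp _ hcz n)
      (hC.meets_mono_right hyw (hC.meets_comp_of_isHomCompl_id hn hc hy hcy))
  · exact hC.meets_mono_left (homLE_comp _ hbz n)
      (hC.meets_comp_of_isHomCompl_id hn hb hw hbw)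

/-- If there were no atom below `x`, the projection onto the support of `x` would lie below both
the identity and its complement. -/
theorem exists_isHomAtom_homLE {X : C} [Closed X] {x : 𝟙_ C ⟶ X} (hx : x ≠ 0) :
    ∃ a, IsHomAtom hC.biproducts a ∧ homLE hC.biproducts a x := by
  by_contra! no_atom
  obtain ⟨n, hn⟩ := hC.exists_isHomCompl (𝟙 X)
  obtain ⟨q, -, q_le_id, x_comp_q, comp_q_le⟩ := hC.exists_support x
  have q_le_n : homLE hC.biproducts q n := hC.homLE_iff.2 fun y w hw =>
    have y_comp_q_le : homLE hC.biproducts (y ≫ q) y := by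
      simpa only [Category.comp_id] using comp_homLE_comp _ q_le_id y
    hC.meets_mono_left (homLE_comp _ y_comp_q_le n)
      (hC.meets_comp_of_not_isHomAtom hn (hC.ne_zero_of_meets_left hw)
        (fun h => no_atom _ h (comp_q_le y)) (hC.ne_zero_of_meets_right hw))
  exact hx (by rw [← x_comp_q, hn.eq_zero_of_le q q_le_id q_le_n, comp_zero])

end RelAxioms

end Boolean

/-! ### Bases of points and the functor of atoms -/

section PointBasis

variable {C : Type u} [Category.{v} C] [DaggerCategory C] [MonoidalCategory C]

/-- A family of points `𝟙_ C ⟶ X` is a basis if it is orthonormal and complete, where completeness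
states `∑ m, (e m)‡ ≫ e m = 𝟙 X` in terms of `Meets`. -/
structure IsPointBasis {M : Type v} {X : C} (e : M → (𝟙_ C ⟶ X)) : Prop where
  orthonormal : ∀ i j, Meets (e i) (e j) ↔ i = j
  complete : ∀ x w, Meets x w ↔ ∃ m, Meets x (e m) ∧ Meets (e m) w

variable [HasZeroMorphisms C] (hC : RelAxioms C)

include hC in
theorem RelAxioms.meets_comp_dagger_comp_iff {X Y : C} {x u : 𝟙_ C ⟶ X} {v w : 𝟙_ C ⟶ Y} :
    Meets (x ≫ u‡ ≫ v) w ↔ Meets x u ∧ Meets v w := by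
  rw [Meets, Category.assoc, Category.assoc, ← Category.assoc, hC.scalar_comp_eq_id_iff]
  rfl

namespace IsPointBasis

variable {M N : Type v} {X Y : C} {e : M → (𝟙_ C ⟶ X)} {e' : N → (𝟙_ C ⟶ Y)}

include hC

theorem hom_ext_meets (he : IsPointBasis e) (he' : IsPointBasis e') {r s : X ⟶ Y}
    (hrs : ∀ i j, Meets (e i ≫ r) (e' j) ↔ Meets (e i ≫ s) (e' j)) : r = s := by
  have meets_iff (t : X ⟶ Y) (x : 𝟙_ C ⟶ X) (y : 𝟙_ C ⟶ Y) : Meets (x ≫ t) y ↔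
      ∃ i, Meets x (e i) ∧ ∃ j, Meets (e i ≫ t) (e' j) ∧ Meets (e' j) y := by
    rw [meets_comp_iff, he.complete]
    refine exists_congr fun i => and_congr_right fun _ => ?_
    rw [← meets_comp_iff, he'.complete]
  refine hC.hom_ext_meets fun x y => ?_
  rw [meets_iff r, meets_iff s]
  simp only [hrs]

theorem homSum_eq_id (he : IsPointBasis e) :
    homSum hC.biproducts (fun m => (e m)‡ ≫ e m) = 𝟙 X :=
  hC.hom_ext_meets fun x y => by
    rw [comp_homSum, hC.meets_homSum_iff, Category.comp_id, he.complete]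
    simp only [hC.meets_comp_dagger_comp_iff]

variable (he : IsPointBasis e)

include he

theorem homLE_of_meets {m : M} {x : 𝟙_ C ⟶ X} (h : Meets x (e m)) :
    homLE hC.biproducts (e m) x :=
  hC.homLE_point_iff.2 fun _ hw => (he.complete _ _).2 ⟨m, h, hw⟩

theorem ne_zero (m : M) : e m ≠ 0 :=
  hC.meets_self_iff.1 ((he.orthonormal m m).2 rfl)

theorem isHomAtom (m : M) : IsHomAtom hC.biproducts (e m) := by
  refine ⟨he.ne_zero hC m, fun b hb => or_iff_not_imp_left.2 fun hb0 => ?_⟩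
  obtain ⟨k, hbk, -⟩ := (he.complete _ _).1 (hC.meets_self_iff.2 hb0)
  obtain rfl := (he.orthonormal m k).1 (hC.meets_mono_left hb hbk)
  exact hC.homLE_antisymm hb (he.homLE_of_meets hC hbk)

theorem exists_eq {a : 𝟙_ C ⟶ X} (ha : IsHomAtom hC.biproducts a) : ∃ m, e m = a := by
  obtain ⟨m, ham, -⟩ := (he.complete _ _).1 (hC.meets_self_iff.2 ha.1)
  exact ⟨m, (ha.2 _ (he.homLE_of_meets hC ham)).resolve_left (he.ne_zero hC m)⟩

/-- The indexing set of a basis of `X` is identified with the set of atoms of `X`. -/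
noncomputable def equivAtom : M ≃ AtomObj hC.biproducts X :=
  Equiv.ofBijective (fun m => ⟨e m, he.isHomAtom hC m⟩)
    ⟨fun i j h => (he.orthonormal i j).1 <| by
      rw [show e i = e j from Subtype.ext_iff.1 h]
      exact (he.orthonormal j j).2 rfl,
    fun a => (he.exists_eq hC a.2).imp fun _ h => Subtype.ext h⟩

end IsPointBasis

theorem AtomObj.ext {h : HasDaggerBiproducts C} {X : C} {a b : AtomObj h X}
    (hab : a.mor = b.mor) : a = b := Subtype.ext hab

include hC in
theorem isPointBasis_id_unit : IsPointBasis fun _ : PUnit.{v + 1} => 𝟙 (𝟙_ C) where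
  orthonormal _ _ := by simp [Meets]
  complete x w := by simp [Meets, hC.scalar_comp_eq_id_iff]

include hC in
theorem DaggerBiproduct.isPointBasis {M : Type v} (B : DaggerBiproduct fun _ : M => 𝟙_ C) :
    IsPointBasis B.bicone.ι where
  orthonormal i j := by
    rw [Meets, ← B.π_eq]
    by_cases h : i = j
    · subst h
      simp
    · simpa [h] using hC.id_unit_ne_zero.symm
  complete x w := by
    have homSum_eq_id :
        homSum hC.biproducts (fun m => (B.bicone.ι m)‡ ≫ B.bicone.ι m) = 𝟙 _ :=
      B.hom_ext_ι fun j => by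
        rw [comp_homSum, homSum_single _ _ j] <;>
          simp +contextual [← B.π_eq, Ne.symm]
    conv_lhs => rw [← Category.comp_id x, ← homSum_eq_id, comp_homSum]
    simp only [hC.meets_homSum_iff, hC.meets_comp_dagger_comp_iff]

theorem isPointBasis_atom (X : C) [Closed X] :
    IsPointBasis fun a : AtomObj hC.biproducts X => a.mor := by
  have eq_of_homLE (a : AtomObj hC.biproducts X) {z : 𝟙_ C ⟶ X} (hz : z ≠ 0)
      (hza : homLE hC.biproducts z a.mor) : z = a.mor :=
    (a.2.2 z hza).resolve_left hz
  refine ⟨fun a b => ⟨fun h => ?_, ?_⟩, fun x w => ⟨fun h => ?_, ?_⟩⟩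
  · obtain ⟨z, hz, hza, hzb⟩ := hC.meets_iff_exists_homLE.1 h
    exact AtomObj.ext ((eq_of_homLE a hz hza).symm.trans (eq_of_homLE b hz hzb))
  · rintro rfl
    exact hC.meets_self_iff.2 a.2.1
  · obtain ⟨z, hz, hzx, hzw⟩ := hC.meets_iff_exists_homLE.1 h
    obtain ⟨a, ha, haz⟩ := hC.exists_isHomAtom_homLE hz
    have meets_self : Meets a a := hC.meets_self_iff.2 ha.1
    exact ⟨⟨a, ha⟩, hC.meets_mono_left hzx (hC.meets_mono_left haz meets_self),
      hC.meets_mono_right hzw (hC.meets_mono_right haz meets_self)⟩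
  · rintro ⟨a, hxa, haw⟩
    obtain ⟨z, hz, hzx, hza⟩ := hC.meets_iff_exists_homLE.1 hxa
    exact hC.meets_mono_left hzx (eq_of_homLE a hz hza ▸ haw)

end PointBasis

section AtomFunctor

variable {C : Type u} [Category.{v} C] [DaggerCategory C] [HasZeroMorphisms C]
  [MonoidalCategory C]

theorem mem_atomMap_iff {h : HasDaggerBiproducts C} {X Y : C} {r : X ⟶ Y} {a : AtomObj h X}
    {b : AtomObj h Y} : (a, b) ∈ (atomMap h r).rel ↔ Meets (a.mor ≫ r) b.mor := by
  rw [Meets, Category.assoc]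
  rfl

theorem isDaggerIso_isoOfEquiv {X Y : Type v} (e : X ≃ Y) :
    IsDaggerIso (RelCat.isoOfEquiv e).hom :=
  ⟨(RelCat.isoOfEquiv e).hom_inv_id, (RelCat.isoOfEquiv e).inv_hom_id⟩

variable (hC : RelAxioms C)

theorem mem_atomMap_dagger_iff {X Y : C} {r : X ⟶ Y} {a : AtomObj hC.biproducts X}
    {b : AtomObj hC.biproducts Y} :
    (b, a) ∈ (atomMap hC.biproducts r‡).rel ↔ (a, b) ∈ (atomMap hC.biproducts r).rel := by
  rw [mem_atomMap_iff, mem_atomMap_iff, hC.meets_comm, ← meets_comp_iff]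

variable [MonoidalClosed C]

theorem atomFunctorial : AtomFunctorial hC.biproducts where
  map_id X := by
    ext ⟨a, b⟩
    rw [mem_atomMap_iff, Category.comp_id]
    exact (isPointBasis_atom hC X).orthonormal a b
  map_comp {X Y Z} r s := by
    ext ⟨a, c⟩
    rw [mem_atomMap_iff, ← Category.assoc, meets_comp_iff, (isPointBasis_atom hC Y).complete]
    simp only [← meets_comp_iff, ← mem_atomMap_iff]
    rfl

/-- The functor `E` of atoms. -/
noncomputable abbrev RelAxioms.atomFunctor : C ⥤ RelCat.{v} :=
  _root_.atomFunctor hC.biproducts (atomFunctorial hC)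

theorem atomMap_homSum {X Y : C}
    (R : Set (AtomObj hC.biproducts X × AtomObj hC.biproducts Y)) :
    atomMap hC.biproducts (homSum hC.biproducts fun p : R => (p.1.1.mor)‡ ≫ p.1.2.mor) =
      RelCat.Hom.ofRel R := by
  ext ⟨a, b⟩
  rw [mem_atomMap_iff, comp_homSum, hC.meets_homSum_iff]
  simp only [hC.meets_comp_dagger_comp_iff, (isPointBasis_atom hC _).orthonormal]
  constructor
  · rintro ⟨⟨⟨_, _⟩, hp⟩, rfl, rfl⟩
    exact hp
  · exact fun hp => ⟨⟨(a, b), hp⟩, rfl, rfl⟩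

theorem isDaggerEquivalence_atomFunctor : IsDaggerEquivalence hC.atomFunctor where
  isDagger f := by
    ext ⟨b, a⟩
    exact mem_atomMap_dagger_iff hC
  faithful := ⟨fun {X Y} r s h =>
    (isPointBasis_atom hC X).hom_ext_meets hC (isPointBasis_atom hC Y) fun a b => by
      rw [← mem_atomMap_iff, ← mem_atomMap_iff]
      exact Set.ext_iff.1 (congrArg RelCat.Hom.rel h) (a, b)⟩
  full := ⟨fun R => ⟨_, atomMap_homSum hC R.rel⟩⟩
  essSurj M := by
    obtain ⟨B⟩ := hC.biproducts M fun _ => 𝟙_ C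
    exact ⟨_, _, isDaggerIso_isoOfEquiv ((B.isPointBasis hC).equivAtom hC).symm⟩

end AtomFunctor

/-! ### The monoidal structure of the functor of atoms -/

section PointTensor

variable {C : Type u} [Category.{v} C] [MonoidalCategory C]

/-- The point `(x ⊗ y) ∘ λ_I⁻¹` of `X ⊗ Y`. -/
def pointTensor {X Y : C} (x : 𝟙_ C ⟶ X) (y : 𝟙_ C ⟶ Y) : 𝟙_ C ⟶ X ⊗ Y :=
  (λ_ (𝟙_ C)).inv ≫ (x ⊗ₘ y)

theorem pointTensor_associator {X Y Z : C} (x : 𝟙_ C ⟶ X) (y : 𝟙_ C ⟶ Y) (z : 𝟙_ C ⟶ Z) :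
    pointTensor (pointTensor x y) z ≫ (α_ X Y Z).hom = pointTensor x (pointTensor y z) := by
  simp only [pointTensor, MonoidalCategory.tensorHom_def]
  monoidal

theorem pointTensor_leftUnitor {X : C} (x : 𝟙_ C ⟶ X) :
    pointTensor (𝟙 _) x ≫ (λ_ X).hom = x := by
  simp [pointTensor]

theorem pointTensor_rightUnitor {X : C} (x : 𝟙_ C ⟶ X) :
    pointTensor x (𝟙 _) ≫ (ρ_ X).hom = x := by
  simp [pointTensor, unitors_inv_equal]

theorem pointTensor_braiding [BraidedCategory C] {X Y : C} (x : 𝟙_ C ⟶ X) (y : 𝟙_ C ⟶ Y) :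
    pointTensor x y ≫ (β_ X Y).hom = pointTensor y x := by
  simp [pointTensor, unitors_inv_equal]

theorem pointTensor_comp_tensorHom {X Y X' Y' : C} (x : 𝟙_ C ⟶ X) (y : 𝟙_ C ⟶ Y) (f : X ⟶ X')
    (g : Y ⟶ Y') : pointTensor x y ≫ (f ⊗ₘ g) = pointTensor (x ≫ f) (y ≫ g) := by
  simp [pointTensor]

theorem leftUnitor_inv_comp_tensorHom_comp_leftUnitor (s t : 𝟙_ C ⟶ 𝟙_ C) :
    (λ_ (𝟙_ C)).inv ≫ (s ⊗ₘ t) ≫ (λ_ (𝟙_ C)).hom = s ≫ t := by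
  simp [MonoidalCategory.tensorHom_def, unitors_equal, unitors_inv_equal]

variable [DaggerCategory C] [SymmetricCategory C] [IsDaggerSymmetricMonoidal C]

theorem pointTensor_dagger {X Y : C} (x : 𝟙_ C ⟶ X) (y : 𝟙_ C ⟶ Y) :
    (pointTensor x y)‡ = (x‡ ⊗ₘ y‡) ≫ (λ_ (𝟙_ C)).hom := by
  rw [pointTensor, DaggerCategory.dagger_comp, IsDaggerSymmetricMonoidal.dagger_tensorHom,
    (IsDaggerSymmetricMonoidal.leftUnitor (𝟙_ C)).dagger_inv]

variable [HasZeroMorphisms C] (hC : RelAxioms C)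

include hC

theorem meets_pointTensor_iff {X Y : C} {x x' : 𝟙_ C ⟶ X} {y y' : 𝟙_ C ⟶ Y} :
    Meets (pointTensor x y) (pointTensor x' y') ↔ Meets x x' ∧ Meets y y' := by
  rw [Meets, pointTensor_dagger, ← Category.assoc, pointTensor_comp_tensorHom, pointTensor,
    Category.assoc, leftUnitor_inv_comp_tensorHom_comp_leftUnitor, hC.scalar_comp_eq_id_iff]
  rfl

theorem IsPointBasis.tensor {M N : Type v} {X Y : C} [Closed X] [Closed Y]
    {e : M → (𝟙_ C ⟶ X)} {e' : N → (𝟙_ C ⟶ Y)} (he : IsPointBasis e) (he' : IsPointBasis e') :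
    IsPointBasis fun p : M × N => pointTensor (e p.1) (e' p.2) where
  orthonormal p q := by
    rw [meets_pointTensor_iff hC, he.orthonormal, he'.orthonormal, Prod.ext_iff]
  complete x w := by
    have homSum_eq_id : homSum hC.biproducts (fun m => homSum hC.biproducts fun n =>
        (pointTensor (e m) (e' n))‡ ≫ pointTensor (e m) (e' n)) = 𝟙 (X ⊗ Y) := by
      have projection_eq (m : M) (n : N) :
          (pointTensor (e m) (e' n))‡ ≫ pointTensor (e m) (e' n) =
            ((e m)‡ ≫ e m) ▷ Y ≫ X ◁ ((e' n)‡ ≫ e' n) := by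
        rw [pointTensor_dagger, pointTensor, ← MonoidalCategory.tensorHom_def]
        simp
      simp_rw [projection_eq, ← comp_homSum, ← whiskerLeft_homSum, he'.homSum_eq_id hC,
        MonoidalCategory.whiskerLeft_id, Category.comp_id, ← homSum_whiskerRight,
        he.homSum_eq_id hC, MonoidalCategory.id_whiskerRight]
    conv_lhs => rw [← Category.comp_id x, ← homSum_eq_id]
    simp only [comp_homSum, hC.meets_homSum_iff, hC.meets_comp_dagger_comp_iff, Prod.exists]

end PointTensor

section Graph

variable {X Y : Type v} {Z W : RelCat.{v}}

/-- The graph of a function, as a morphism of the category of relations. -/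
def relGraph (f : X → Y) : Quiver.Hom (V := RelCat.{v}) X Y :=
  RelCat.Hom.ofRel {p | f p.1 = p.2}

theorem mem_relGraph_comp_iff {f : X → Y} {R : Quiver.Hom (V := RelCat.{v}) Y Z} {x : X} {z : Z} :
    (x, z) ∈ (relGraph f ≫ R).rel ↔ (f x, z) ∈ R.rel :=
  ⟨fun ⟨_, hf, hR⟩ => (show f x = _ from hf) ▸ hR, fun hR => ⟨f x, rfl, hR⟩⟩

theorem mem_comp_relGraph_iff {f : X → Y} (hf : f.Injective)
    {R : Quiver.Hom (V := RelCat.{v}) Z X} {z : Z} {x : X} :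
    (z, f x) ∈ (R ≫ relGraph f).rel ↔ (z, x) ∈ R.rel :=
  ⟨fun ⟨_, hR, hx⟩ => hf hx ▸ hR, fun hR => ⟨x, hR, rfl⟩⟩

theorem mem_relGraph_whiskerRight_comp_iff {f : X → Y}
    {R : tensorObj (C := RelCat.{v}) Y Z ⟶ W} {x : X} {z : Z} {w : W} :
    ((x, z), w) ∈ (relGraph f ▷ Z ≫ R).rel ↔ ((f x, z), w) ∈ R.rel := by
  refine ⟨fun ⟨(y, z'), ⟨hf, hz⟩, hR⟩ => ?_, fun hR => ⟨(f x, z), ⟨rfl, rfl⟩, hR⟩⟩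
  obtain rfl : f x = y := hf
  obtain rfl : z = z' := hz
  exact hR

theorem mem_whiskerLeft_relGraph_comp_iff {f : X → Y}
    {R : tensorObj (C := RelCat.{v}) Z Y ⟶ W} {z : Z} {x : X} {w : W} :
    ((z, x), w) ∈ (Z ◁ relGraph f ≫ R).rel ↔ ((z, f x), w) ∈ R.rel := by
  refine ⟨fun ⟨(z', y), ⟨hz, hf⟩, hR⟩ => ?_, fun hR => ⟨(z, f x), ⟨rfl, rfl⟩, hR⟩⟩
  obtain rfl : z = z' := hz
  obtain rfl : f x = y := hf
  exact hR

end Graph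

section Monoidal

variable {C : Type u} [Category.{v} C] [DaggerCategory C] [HasZeroMorphisms C]
  [MonoidalCategory C] [MonoidalClosed C] (hC : RelAxioms C)

theorem mem_atomMap_iff_eq {X Y : C} {r : X ⟶ Y} {a : AtomObj hC.biproducts X}
    {b c : AtomObj hC.biproducts Y} (h : a.mor ≫ r = b.mor) :
    (a, c) ∈ (atomMap hC.biproducts r).rel ↔ b = c := by
  rw [mem_atomMap_iff, h]
  exact (isPointBasis_atom hC Y).orthonormal b c

/-- The unit comparison of the functor of atoms. -/
noncomputable def atomUnitIso : 𝟙_ RelCat.{v} ≅ hC.atomFunctor.obj (𝟙_ C) :=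
  RelCat.isoOfEquiv ((isPointBasis_id_unit hC).equivAtom hC)

variable [SymmetricCategory C] [IsDaggerSymmetricMonoidal C]

/-- The bijection from pairs of atoms to the atoms of a tensor product. -/
noncomputable def atomTensorEquiv (X Y : C) :
    AtomObj hC.biproducts X × AtomObj hC.biproducts Y ≃ AtomObj hC.biproducts (X ⊗ Y) :=
  ((isPointBasis_atom hC X).tensor hC (isPointBasis_atom hC Y)).equivAtom hC

/-- The tensor comparison of the functor of atoms. -/
noncomputable def atomTensorIso (X Y : C) :
    hC.atomFunctor.obj X ⊗ hC.atomFunctor.obj Y ≅ hC.atomFunctor.obj (X ⊗ Y) :=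
  RelCat.isoOfEquiv (atomTensorEquiv hC X Y)

theorem tensorHom_comp_atomTensorIso_hom {X Y X' Y' : C} (f : X ⟶ X') (g : Y ⟶ Y') :
    (hC.atomFunctor.map f ⊗ₘ hC.atomFunctor.map g) ≫ (atomTensorIso hC X' Y').hom =
      (atomTensorIso hC X Y).hom ≫ hC.atomFunctor.map (f ⊗ₘ g) := by
  ext ⟨p, c⟩
  obtain ⟨q, rfl⟩ := (atomTensorEquiv hC X' Y').surjective c
  refine (mem_comp_relGraph_iff (atomTensorEquiv hC X' Y').injective).trans
    (Iff.trans ?_ mem_relGraph_comp_iff.symm)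
  refine (and_congr mem_atomMap_iff mem_atomMap_iff).trans (Iff.trans ?_ mem_atomMap_iff.symm)
  rw [← meets_pointTensor_iff hC, ← pointTensor_comp_tensorHom]
  rfl

/-- The comparison isomorphisms make the functor of atoms strong monoidal. -/
noncomputable def atomCoreMonoidal : hC.atomFunctor.CoreMonoidal where
  εIso := atomUnitIso hC
  μIso := atomTensorIso hC
  μIso_hom_natural_left f X' := by
    simpa using tensorHom_comp_atomTensorIso_hom hC f (𝟙 X')
  μIso_hom_natural_right X' f := by
    simpa using tensorHom_comp_atomTensorIso_hom hC (𝟙 X') f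
  associativity X Y Z := by
    ext ⟨⟨⟨a, b⟩, c⟩, d⟩
    refine mem_relGraph_whiskerRight_comp_iff.trans (mem_relGraph_comp_iff.trans ?_)
    refine Iff.trans ?_ ((mem_relGraph_comp_iff (f := Equiv.prodAssoc _ _ _)).trans
      mem_whiskerLeft_relGraph_comp_iff).symm
    exact mem_atomMap_iff_eq hC (pointTensor_associator _ _ _)
  left_unitality X := by
    ext ⟨⟨u, a⟩, b⟩
    refine Iff.symm (mem_relGraph_whiskerRight_comp_iff.trans
      (mem_relGraph_comp_iff.trans ?_))
    exact mem_atomMap_iff_eq hC (pointTensor_leftUnitor _)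
  right_unitality X := by
    ext ⟨⟨a, u⟩, b⟩
    refine Iff.symm (mem_whiskerLeft_relGraph_comp_iff.trans
      (mem_relGraph_comp_iff.trans ?_))
    exact mem_atomMap_iff_eq hC (pointTensor_rightUnitor _)

/-- The comparison isomorphisms make the functor of atoms strong symmetric monoidal. -/
@[reducible]
noncomputable def atomBraided : hC.atomFunctor.Braided where
  toMonoidal := (atomCoreMonoidal hC).toMonoidal
  braided X Y := by
    ext ⟨⟨a, b⟩, c⟩
    refine mem_relGraph_comp_iff.trans (Iff.trans ?_ mem_relGraph_comp_iff.symm)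
    exact mem_atomMap_iff_eq hC (pointTensor_braiding _ _)

theorem isAtomMonoidalDaggerEquivalence :
    IsAtomMonoidalDaggerEquivalence hC.biproducts (atomFunctorial hC) where
  daggerEquivalence := isDaggerEquivalence_atomFunctor hC
  monoidal := by
    refine ⟨atomBraided hC, ?_, isDaggerIso_isoOfEquiv _, fun X Y => ?_,
      fun _ _ => isDaggerIso_isoOfEquiv _⟩
    · ext ⟨_, a⟩
      exact Subtype.ext_iff.trans eq_comm
    · ext ⟨_, a⟩
      exact Subtype.ext_iff.trans eq_comm

end Monoidal

/-! ### The category of relations -/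

section Rel

theorem relHom_eq_zero_iff {X Y : RelCat.{v}} {R : X ⟶ Y} : R = 0 ↔ ∀ x y, (x, y) ∉ R.rel := by
  refine ⟨fun hR x y hxy => ?_, fun hR => ?_⟩
  · subst hR
    exact hxy
  · ext ⟨x, y⟩
    exact iff_of_false (hR x y) id

instance isDaggerSymmetricMonoidal_relCat : IsDaggerSymmetricMonoidal RelCat.{v} where
  dagger_tensorHom _ _ := rfl
  associator _ _ _ := isDaggerIso_isoOfEquiv _
  leftUnitor _ := isDaggerIso_isoOfEquiv _
  rightUnitor _ := isDaggerIso_isoOfEquiv _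
  braiding _ _ := isDaggerIso_isoOfEquiv _

/-- The self-duality of a set `X`, whose unit and counit are the equality relation on `X`. -/
@[reducible]
def relExactPairing (X : RelCat.{v}) : ExactPairing X X where
  coevaluation' := RelCat.Hom.ofRel {p : 𝟙_ RelCat.{v} × @Prod.{v, v} X X | p.2.1 = p.2.2}
  evaluation' := RelCat.Hom.ofRel {p : @Prod.{v, v} X X × 𝟙_ RelCat.{v} | p.1.1 = p.1.2}
  coevaluation_evaluation' := by
    ext ⟨⟨x, ⟨⟩⟩, ⟨⟨⟩, y⟩⟩
    constructor
    · rintro ⟨⟨a, b, c⟩, ⟨hxa, hbc⟩, ⟨⟨⟨a', b'⟩, c'⟩, hassoc, ⟨hab, hcy⟩⟩⟩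
      cases (show (a', b', c') = (a, b, c) from hassoc)
      exact ⟨x, rfl, (hxa.trans (hab.trans (hbc.trans hcy))).symm⟩
    · rintro ⟨z, hxz, hyz⟩
      cases hxz
      cases hyz
      exact ⟨(x, x, x), ⟨rfl, rfl⟩, ⟨((x, x), x), rfl, ⟨rfl, rfl⟩⟩⟩
  evaluation_coevaluation' := by
    ext ⟨⟨⟨⟩, x⟩, ⟨y, ⟨⟩⟩⟩
    constructor
    · rintro ⟨⟨⟨a, b⟩, c⟩, ⟨hab, hxc⟩, ⟨⟨a', b', c'⟩, hassoc, ⟨hay, hbc⟩⟩⟩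
      cases (show (a, b, c) = (a', b', c') from hassoc)
      exact ⟨x, rfl, hay.symm.trans (hab.trans (hbc.trans hxc.symm))⟩
    · rintro ⟨z, hxz, hyz⟩
      cases hxz
      cases hyz
      exact ⟨((x, x), x), ⟨rfl, rfl⟩, ⟨(x, x, x), rfl, ⟨rfl, rfl⟩⟩⟩

instance isDaggerCompactClosed_relCat : IsDaggerCompactClosed RelCat.{v} where
  exists_dual X := by
    refine ⟨X, relExactPairing X, ?_⟩
    ext ⟨⟨x, y⟩, u⟩
    refine Iff.trans ?_ (mem_relGraph_comp_iff (f := Equiv.prodComm X X)).symm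
    exact eq_comm

/-- The disjoint union of sets, with the graphs of the inclusions and their converses. -/
def relBicone {M : Type v} (f : M → RelCat.{v}) : Bicone f where
  pt := (Σ m, (f m : Type v) : Type v)
  π m := (relGraph (Sigma.mk m))‡
  ι m := relGraph (Sigma.mk m)
  ι_π i j := by
    ext ⟨x, y⟩
    refine mem_relGraph_comp_iff.trans ?_
    split_ifs with hij
    · subst hij
      exact eq_comm.trans sigma_mk_injective.eq_iff
    · exact iff_of_false (fun h => hij (Sigma.mk.inj h).1.symm) id

/-- The universal property of the disjoint union as a coproduct of sets and relations. -/
def relBiconeIsColimit {M : Type v} (f : M → RelCat.{v}) : IsColimit (relBicone f).toCocone :=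
  Cofan.IsColimit.mk _
    (fun s => RelCat.Hom.ofRel {p | (p.1.2, p.2) ∈ (s.inj p.1.1).rel})
    (fun s m => by
      ext ⟨x, y⟩
      exact mem_relGraph_comp_iff)
    (fun s R hR => by
      ext ⟨⟨m, x⟩, y⟩
      exact mem_relGraph_comp_iff.symm.trans (iff_of_eq (congrArg ((x, y) ∈ ·.rel) (hR m))))

theorem isDaggerMono_relGraph {X Y : Type v} {f : X → Y} (hf : f.Injective) :
    IsDaggerMono (relGraph f) := by
  ext ⟨x, x'⟩
  exact mem_relGraph_comp_iff.trans (eq_comm.trans hf.eq_iff)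

/-- The kernel of a relation: the elements that are not related to anything. -/
def relKernel {X Y : RelCat.{v}} (R : X ⟶ Y) : Type v :=
  {x : X // ∀ y : Y, (x, y) ∉ R.rel}

theorem isKernelOf_relGraph_val {X Y : RelCat.{v}} (R : X ⟶ Y) :
    IsKernelOf (relGraph (Subtype.val : relKernel R → X)) R := by
  have : Mono (relGraph (Subtype.val : relKernel R → X)) :=
    (isDaggerMono_relGraph Subtype.val_injective).mono
  refine ⟨relHom_eq_zero_iff.2 fun x y h => x.2 y (mem_relGraph_comp_iff.1 h),
    ⟨KernelFork.IsLimit.ofι' _ _ fun S hS => ⟨RelCat.Hom.ofRel {p | (p.1, p.2.1) ∈ S.rel}, ?_⟩⟩⟩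
  ext ⟨w, x⟩
  refine ⟨fun ⟨x', hS, hx⟩ => (show x'.1 = x from hx) ▸ hS, fun hx => ?_⟩
  exact ⟨⟨x, fun y hy => relHom_eq_zero_iff.1 hS w y ⟨x, hx, hy⟩⟩, hx, rfl⟩

/-- The point of a set `X` of the category of relations given by an element of `X`. -/
abbrev relPoint {X : RelCat.{v}} (x : X) : 𝟙_ RelCat.{v} ⟶ X :=
  relGraph fun _ => x

theorem relHom_ext_point {X Y : RelCat.{v}} {R S : X ⟶ Y}
    (h : ∀ x, relPoint x ≫ R = relPoint x ≫ S) : R = S := by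
  ext ⟨x, y⟩
  have mem_iff (T : X ⟶ Y) : (PUnit.unit, y) ∈ (relPoint x ≫ T).rel ↔ (x, y) ∈ T.rel :=
    mem_relGraph_comp_iff
  rw [← mem_iff R, ← mem_iff S, h]

theorem relPoint_comp_eq_zero_iff {X Y : RelCat.{v}} {R : X ⟶ Y} {x : X} :
    relPoint x ≫ R = 0 ↔ ∀ y, (x, y) ∉ R.rel :=
  relHom_eq_zero_iff.trans
    ⟨fun h y hy => h PUnit.unit y (mem_relGraph_comp_iff.2 hy),
      fun h _ y hy => h y (mem_relGraph_comp_iff.1 hy)⟩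

theorem exists_comp_eq_relPoint {A A' X Y : RelCat.{v}} {k : A ⟶ X} {k' : A' ⟶ X} {R : X ⟶ Y}
    (hk : IsKernelOf k R) (hk' : IsKernelOf k' (k‡)) (x : X) :
    (∃ l, l ≫ k = relPoint x) ∨ ∃ l, l ≫ k' = relPoint x := by
  by_cases hx : ∃ a : A, (a, x) ∈ k.rel
  · obtain ⟨a, ha⟩ := hx
    refine .inl (hk.exists_fac _ (relPoint_comp_eq_zero_iff.2 fun y hy => ?_))
    exact relHom_eq_zero_iff.1 hk.condition a y ⟨x, ha, hy⟩
  · exact .inr (hk'.exists_fac _ (relPoint_comp_eq_zero_iff.2 fun a ha => hx ⟨a, ha⟩))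

theorem relScalar_eq_id {s : 𝟙_ RelCat.{v} ⟶ 𝟙_ RelCat.{v}} (hs : s ≠ 0) : s = 𝟙 _ := by
  rw [Ne, relHom_eq_zero_iff] at hs
  push Not at hs
  obtain ⟨⟨⟩, ⟨⟩, h⟩ := hs
  ext ⟨⟨⟩, ⟨⟩⟩
  exact iff_of_true h rfl

theorem relAxioms_relCat : RelAxioms RelCat.{v} where
  biproducts _ f := ⟨.ofIsColimit _ (relBiconeIsColimit f) fun _ => rfl⟩
  kernels R := ⟨_, _, isKernelOf_relGraph_val R, isDaggerMono_relGraph Subtype.val_injective⟩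
  jointlyEpic {A A' X} k k' hk hk' Y f g h h' := by
    obtain ⟨-, W, R, hR⟩ := hk
    refine relHom_ext_point fun x => ?_
    obtain ⟨l, hl⟩ | ⟨l, hl⟩ := exists_comp_eq_relPoint hR hk'.2 x
    · rw [← hl, Category.assoc, h, Category.assoc]
    · rw [← hl, Category.assoc, h', Category.assoc]
  unit_nonzero h :=
    relHom_eq_zero_iff.1 ((IsZero.iff_id_eq_zero _).1 h) PUnit.unit PUnit.unit rfl
  scalar_invertible s hs := by
    rw [relScalar_eq_id hs]
    infer_instance
  separator := (isSeparator_def _).2 fun _ _ _ _ h => relHom_ext_point fun _ => h _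

end Rel

/-- The closed structure of a dagger compact closed category, in which `X ⊗ -` is left adjoint to
`D ⊗ -` for a chosen dual `D` of `X`. -/
@[reducible]
noncomputable def IsDaggerCompactClosed.monoidalClosed (C : Type u) [Category.{v} C]
    [DaggerCategory C] [MonoidalCategory C] [SymmetricCategory C] [IsDaggerCompactClosed C] :
    MonoidalClosed C where
  closed X :=
    let _ : HasLeftDual X :=
      { leftDual := _, exact := (IsDaggerCompactClosed.exists_dual X).choose_spec.choose }
    closedOfHasLeftDual X

theorem theorem5_general :
    (∀ (C : Type u) [Category.{v} C] [DaggerCategory C] [HasZeroMorphisms C]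
        [MonoidalCategory C] [SymmetricCategory C] [IsDaggerSymmetricMonoidal C]
        [MonoidalClosed C] (hC : RelAxioms C),
      ∃ hE : AtomFunctorial hC.biproducts,
        IsAtomMonoidalDaggerEquivalence hC.biproducts hE) ∧
    IsDaggerCompactClosed RelCat.{v} ∧ RelAxioms RelCat.{v} :=
  ⟨fun _ _ _ _ _ _ _ _ hC => ⟨_, isAtomMonoidalDaggerEquivalence hC⟩,
    isDaggerCompactClosed_relCat, relAxioms_relCat⟩

theorem theorem5 :
    (∀ (C : Type u) [Category.{v} C] [DaggerCategory C] [HasZeroMorphisms C]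
        [MonoidalCategory C] [SymmetricCategory C] [IsDaggerCompactClosed C]
        (hC : RelAxioms C),
      ∃ hE : AtomFunctorial hC.biproducts,
        IsAtomMonoidalDaggerEquivalence hC.biproducts hE) ∧
    IsDaggerCompactClosed RelCat.{v} ∧ RelAxioms RelCat.{v} :=
  ⟨fun C _ _ _ _ _ _ hC =>
    let _ := IsDaggerCompactClosed.monoidalClosed C
    theorem5_general.{v, u}.1 C hC, theorem5_general.{v, u}.2⟩
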